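/- All matroids are finite. For matroids $M(S)$ and $N(T)$ on disjoint sets with rank functions $\rho_M,\rho_N$, the free product $M\mathbin{\Box}N$ is the matroid on $S\cup T$ whose independent sets are the $A\subseteq S\cup T$ such that $A\cap S$ is independent in $M$ and $\rho_M(S)-\rho_M(A\cap S)\ge |A\cap T|-\rho_N(A\cap T)$. A nonempty matroid is irreducible if every factorization of it as a free product of matroids contains it as a factor; every matroid has a sequence of irreducible factors $M_1,\dots,M_k$ with $M\cong M_1\mathbin{\Box}\cdots\mathbin{\Box}M_k$, unique up to isomorphism. Matroids are identified with their isomorphism classes. Let $\mathcal M$ be a nonempty family of matroids that is closed under minors and free products, and let $K$ be a field of characteristic zero. The minor coalgebra $K\{\mathcal M\}$ is the $K$-vector space with basis the isomorphism classes in $\mathcal M$, with coproduct $\delta(M)=\sum_{A\subseteq S}M|A\otimes M/A$ and counit $\epsilon(M)=\delta_{\emptyset,S}$ for $M=M(S)$; the empty matroid $\emptyset$ is a group-like element. For $M,N\in\mathcal M$ let $c(N,M)$ be the number of sequences $\emptyset=S_0\subseteq S_1\subseteq\cdots\subseteq S_k=E(N)$ such that $(N|S_i)/S_{i-1}\cong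 M_i$ for $1\le i\le k$, where $M_1,\dots,M_k$ is the sequence of irreducible factors of $M$. Let $\langle\cdot,\cdot\rangle$ be the bilinear form on $K\{\mathcal M\}$ for which the isomorphism classes are orthonormal, and let $P_M=\sum_{N\in\mathcal M}c(N,M)\,N$. Theorem. There is a unique family $(Q_M)_{M\in\mathcal M}$ in $K\{\mathcal M\}$ with $\langle Q_M,P_N\rangle=\delta_{M,N}$ for all $M,N\in\mathcal M$, and it is a basis of $K\{\mathcal M\}$. Moreover: 1. The minor coalgebra $K\{\mathcal M\}$ is cofree, cogenerated by the irreducible matroids in $\mathcal M$. That is, let $V$ be the vector space with basis the irreducible $M\in\mathcal M$. Then $K\{\mathcal M\}$ is connected, and there is a linear map $p\colon K\{\mathcal M\}\to V$ with $p(\emptyset)=0$ and $p(Q_M)=M$ for every irreducible $M\in\mathcal M$, such that for every connected coalgebra $D$ over $K$ with group-like element $d$ and every linear map $f\colon D\to V$ with $f(d)=0$ there is a unique coalgebra morphism $\varphi\colon D\to K\{\mathcal M\}$ with $\varphi(d)=\emptyset$ and $p\circ\varphi=f$. (A coalgebra $D$ with coproduct $\Delta$ and group-like element $d$ is connected if $D=\bigcup_n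 F_n$, where $F_0=Kd$ and $F_{n+1}=\Delta^{-1}(F_n\otimes D+D\otimes F_0)$.) 2. The family of elements $Q_M$, for $M\in\mathcal M$ irreducible, is a basis of the subspace of primitive elements $\{x : \delta(x)=x\otimes\emptyset+\emptyset\otimes x\}$ of $K\{\mathcal M\}$. -/

import Mathlib

open scoped TensorProduct

universe u v v' w

noncomputable section

namespace FreeProd

/-! ### Isomorphism, rank-lack, nullity and the free product -/

section Basic

variable {α β γ : Type*}

/-- `f` restricts to a bijection of the ground sets which preserves and reflects independence. -/
def IsIsoMap (f : α → β) (M : Matroid α) (N : Matroid β) : Prop :=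
  Set.BijOn f M.E N.E ∧ ∀ I ⊆ M.E, (M.Indep I ↔ N.Indep (f '' I))

/-- The rank of `A` in `M`, as an integer. -/
def rk (M : Matroid α) (A : Set α) : ℤ := ((M.eRk A).toNat : ℤ)

/-- The rank-lack of `A` in `M`: the rank of `M` minus the rank of `A`. -/
def rankLack (M : Matroid α) (A : Set α) : ℤ := rk M M.E - rk M A

/-- The nullity of `A` in `M`: the size of `A` minus the rank of `A`. -/
def nullity (M : Matroid α) (A : Set α) : ℤ := (A.ncard : ℤ) - rk M A

theorem rk_mono (M : Matroid α) [M.Finite] {A B : Set α} (h : A ⊆ B) : rk M A ≤ rk M B := by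
  unfold rk
  have h1 : M.eRk B ≠ ⊤ := by
    have := M.eRk_le_eRank B
    exact ne_top_of_le_ne_top (M.eRank_ne_top_iff.2 inferInstance) this
  exact_mod_cast ENat.toNat_le_toNat (M.eRk_mono h) h1

theorem rk_le_ncard (M : Matroid α) {A : Set α} (hA : A.Finite) : rk M A ≤ A.ncard := by
  unfold rk
  have := ENat.toNat_le_toNat (M.eRk_le_encard A) (Set.encard_ne_top_iff.2 hA)
  exact_mod_cast this

theorem rk_of_indep {M : Matroid α} {A : Set α} (hA : M.Indep A) : rk M A = A.ncard := by
  unfold rk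
  rw [hA.eRk_eq_encard]; rfl

theorem rk_insert_le (M : Matroid α) [M.Finite] (e : α) (A : Set α) :
    rk M (insert e A) ≤ rk M A + 1 := by
  unfold rk
  have h1 : M.eRk A ≠ ⊤ :=
    ne_top_of_le_ne_top (M.eRank_ne_top_iff.2 inferInstance) (M.eRk_le_eRank A)
  have h := ENat.toNat_le_toNat (M.eRk_insert_le_add_one e A) (by simpa using h1)
  rw [ENat.toNat_add h1 (by simp)] at h
  exact_mod_cast h

theorem exists_rk_insert {M : Matroid α} [M.Finite] {A B : Set α} (h : rk M A < rk M B) :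
    ∃ e ∈ B \ A, rk M (insert e A) = rk M A + 1 := by
  have hA : M.eRk A ≠ ⊤ :=
    ne_top_of_le_ne_top (M.eRank_ne_top_iff.2 inferInstance) (M.eRk_le_eRank A)
  have hB : M.eRk B ≠ ⊤ :=
    ne_top_of_le_ne_top (M.eRank_ne_top_iff.2 inferInstance) (M.eRk_le_eRank B)
  have h' : M.eRk A < M.eRk B := by
    rw [← ENat.natCast_toNat hA, ← ENat.natCast_toNat hB]
    unfold rk at h
    exact_mod_cast h
  obtain ⟨e, he, hr⟩ := M.exists_eRk_insert_eq_add_one_of_lt h'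
  refine ⟨e, he, ?_⟩
  unfold rk
  rw [hr, ENat.toNat_add hA (by simp)]
  simp

/-- Independence in the free product of `M` and `N`: the part in `M` is independent and its
rank-lack is at least the nullity of the part in `N`. -/
def FreeProductIndep (M : Matroid α) (N : Matroid β) (A : Set (α ⊕ β)) : Prop :=
  M.Indep (Sum.inl ⁻¹' A) ∧ Sum.inr ⁻¹' A ⊆ N.E ∧
    nullity N (Sum.inr ⁻¹' A) ≤ rankLack M (Sum.inl ⁻¹' A)

theorem ncard_sum {A : Set (α ⊕ β)} (hA : A.Finite) :
    A.ncard = (Sum.inl ⁻¹' A).ncard + (Sum.inr ⁻¹' A).ncard := by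
  have h : A = Sum.inl '' (Sum.inl ⁻¹' A) ∪ Sum.inr '' (Sum.inr ⁻¹' A) :=
    (Set.image_preimage_inl_union_image_preimage_inr A).symm
  have h1 : (Sum.inl ⁻¹' A).Finite := hA.preimage Sum.inl_injective.injOn
  have h2 : (Sum.inr ⁻¹' A).Finite := hA.preimage Sum.inr_injective.injOn
  conv_lhs => rw [h]
  rw [Set.ncard_union_eq _ (h1.image _) (h2.image _),
    Set.ncard_image_of_injective _ Sum.inl_injective,
    Set.ncard_image_of_injective _ Sum.inr_injective]
  rw [Set.disjoint_left]
  rintro _ ⟨x, _, rfl⟩ ⟨y, _, hy⟩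
  cases hy

theorem preimage_inl_insert_inl (a : α) (A : Set (α ⊕ β)) :
    Sum.inl ⁻¹' (insert (Sum.inl a) A) = insert a (Sum.inl ⁻¹' A) := by
  ext; simp

theorem preimage_inr_insert_inl (a : α) (A : Set (α ⊕ β)) :
    Sum.inr ⁻¹' (insert (Sum.inl a) A) = Sum.inr ⁻¹' A := by
  ext; simp

theorem preimage_inl_insert_inr (b : β) (A : Set (α ⊕ β)) :
    Sum.inl ⁻¹' (insert (Sum.inr b) A) = Sum.inl ⁻¹' A := by
  ext; simp

theorem preimage_inr_insert_inr (b : β) (A : Set (α ⊕ β)) :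
    Sum.inr ⁻¹' (insert (Sum.inr b) A) = insert b (Sum.inr ⁻¹' A) := by
  ext; simp

/-- Nullity is monotone. -/
theorem nullity_mono (M : Matroid α) [M.Finite] {A B : Set α} (hAB : A ⊆ B) (hB : B.Finite) :
    nullity M A ≤ nullity M B := by
  have h1 : M.eRk B ≤ M.eRk A + (B \ A).encard :=
    (M.eRk_le_eRk_add_eRk_sdiff hAB).trans (add_le_add_right (M.eRk_le_encard _) _)
  have hA : M.eRk A ≠ ⊤ :=
    ne_top_of_le_ne_top (M.eRank_ne_top_iff.2 inferInstance) (M.eRk_le_eRank A)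
  have hd : (B \ A).encard ≠ ⊤ := Set.encard_ne_top_iff.2 (hB.subset Set.sdiff_subset)
  have h2 := ENat.toNat_le_toNat h1 (by simp [hA, hd])
  rw [ENat.toNat_add hA hd] at h2
  change _ ≤ _ + (B \ A).ncard at h2
  have h3 := Set.ncard_sdiff_add_ncard_of_subset hAB hB
  unfold nullity rk
  omega

theorem freeProductIndep_aug (M : Matroid α) (N : Matroid β) [M.Finite] [N.Finite]
    {A B : Set (α ⊕ β)} (hA : FreeProductIndep M N A) (hB : FreeProductIndep M N B)
    (hAf : A.Finite) (hBf : B.Finite) (hAB : A.ncard < B.ncard) :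
    ∃ e ∈ B, e ∉ A ∧ FreeProductIndep M N (insert e A) := by
  obtain ⟨hA1, hA2, hA3⟩ := hA
  obtain ⟨hB1, hB2, hB3⟩ := hB
  rw [ncard_sum hAf, ncard_sum hBf] at hAB
  have fA1 : (Sum.inl ⁻¹' A).Finite := hAf.preimage Sum.inl_injective.injOn
  have fA2 : (Sum.inr ⁻¹' A).Finite := hAf.preimage Sum.inr_injective.injOn
  have fB2 : (Sum.inr ⁻¹' B).Finite := hBf.preimage Sum.inr_injective.injOn
  have rA := rk_of_indep hA1
  have rB := rk_of_indep hB1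
  rcases lt_or_eq_of_le hA3 with hlt | heq
  · by_cases hsub : Sum.inr ⁻¹' B ⊆ Sum.inr ⁻¹' A
    · have hc := Set.ncard_le_ncard hsub fA2
      have hlt' : (Sum.inl ⁻¹' A).encard < (Sum.inl ⁻¹' B).encard := by
        rw [← fA1.cast_ncard_eq, ← (hBf.preimage Sum.inl_injective.injOn).cast_ncard_eq]
        exact_mod_cast (by omega)
      obtain ⟨e, he, hi⟩ := hA1.augment hB1 hlt'
      refine ⟨Sum.inl e, he.1, he.2, ?_⟩
      unfold FreeProductIndep
      rw [preimage_inl_insert_inl, preimage_inr_insert_inl]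
      refine ⟨hi, hA2, ?_⟩
      have := rk_insert_le M e (Sum.inl ⁻¹' A)
      unfold rankLack at hlt ⊢
      omega
    · obtain ⟨b, hb, hbA⟩ := Set.not_subset.1 hsub
      refine ⟨Sum.inr b, hb, hbA, ?_⟩
      unfold FreeProductIndep
      rw [preimage_inl_insert_inr, preimage_inr_insert_inr]
      refine ⟨hA1, Set.insert_subset (hB2 hb) hA2, ?_⟩
      have h1 := rk_mono N (Set.subset_insert b (Sum.inr ⁻¹' A))
      have h2 := Set.ncard_insert_of_notMem hbA fA2
      unfold nullity at hlt ⊢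
      omega
  · have hr : rk N (Sum.inr ⁻¹' A) < rk N (Sum.inr ⁻¹' B) := by
      unfold nullity rankLack at *
      omega
    obtain ⟨b, hb, hrb⟩ := exists_rk_insert hr
    refine ⟨Sum.inr b, hb.1, hb.2, ?_⟩
    unfold FreeProductIndep
    rw [preimage_inl_insert_inr, preimage_inr_insert_inr]
    refine ⟨hA1, Set.insert_subset (hB2 hb.1) hA2, ?_⟩
    have h2 := Set.ncard_insert_of_notMem hb.2 fA2
    unfold nullity at heq ⊢
    omega

theorem freeProductIndep_subset_ground {M : Matroid α} {N : Matroid β} {A : Set (α ⊕ β)}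
    (hA : FreeProductIndep M N A) : A ⊆ Sum.inl '' M.E ∪ Sum.inr '' N.E := by
  rintro (a | b) h
  · exact Or.inl ⟨a, hA.1.subset_ground h, rfl⟩
  · exact Or.inr ⟨b, hA.2.1 h, rfl⟩

/-- The free product of two finite matroids, on the disjoint union of the ground sets. -/
def freeProduct (M : Matroid α) (N : Matroid β) [M.Finite] [N.Finite] : Matroid (α ⊕ β) :=
  (IndepMatroid.ofFinite (E := Sum.inl '' M.E ∪ Sum.inr '' N.E)
    ((M.ground_finite.image _).union (N.ground_finite.image _))
    (FreeProductIndep M N)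
    (by
      refine ⟨by simp, by simp, ?_⟩
      have := rk_mono M (Set.empty_subset M.E)
      simp only [Set.preimage_empty, nullity, rankLack, Set.ncard_empty]
      have h0 : rk N ∅ = 0 := by simp [rk]
      rw [h0]
      simpa using this)
    (by
      intro I J hJ hIJ
      have hf : J.Finite := ((M.ground_finite.image _).union (N.ground_finite.image _)).subset
        (freeProductIndep_subset_ground hJ)
      have h1 : (Sum.inl ⁻¹' I : Set α) ⊆ Sum.inl ⁻¹' J := Set.preimage_mono hIJ
      have h2 : (Sum.inr ⁻¹' I : Set β) ⊆ Sum.inr ⁻¹' J := Set.preimage_mono hIJ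
      refine ⟨hJ.1.subset h1, h2.trans hJ.2.1, ?_⟩
      have a1 := nullity_mono N h2 (hf.preimage Sum.inr_injective.injOn)
      have a2 := rk_mono M h1
      have a3 := hJ.2.2
      unfold rankLack at *
      omega)
    (by
      intro I J hI hJ h
      have hfin := (M.ground_finite.image (Sum.inl (β := β))).union
        (N.ground_finite.image (Sum.inr (α := α)))
      exact freeProductIndep_aug M N hI hJ (hfin.subset (freeProductIndep_subset_ground hI))
        (hfin.subset (freeProductIndep_subset_ground hJ)) h)
    (fun _ h => freeProductIndep_subset_ground h)).matroid

theorem freeProduct_ground (M : Matroid α) (N : Matroid β) [M.Finite] [N.Finite] :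
    (freeProduct M N).E = Sum.inl '' M.E ∪ Sum.inr '' N.E := rfl

theorem freeProduct_indep_iff (M : Matroid α) (N : Matroid β) [M.Finite] [N.Finite]
    (A : Set (α ⊕ β)) : (freeProduct M N).Indep A ↔ FreeProductIndep M N A := Iff.rfl

theorem IsIsoMap.refl (M : Matroid α) : IsIsoMap id M M :=
  ⟨Set.bijOn_id _, fun I _ => by simp⟩

theorem IsIsoMap.trans {f : α → β} {g : β → γ} {M : Matroid α} {N : Matroid β} {L : Matroid γ}
    (h : IsIsoMap f M N) (h' : IsIsoMap g N L) : IsIsoMap (g ∘ f) M L := by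
  refine ⟨h'.1.comp h.1, fun I hI => ?_⟩
  rw [h.2 I hI, h'.2 _ ((Set.image_mono hI).trans h.1.image_eq.subset), Set.image_comp]

theorem IsIsoMap.exists_symm [Nonempty α] {f : α → β} {M : Matroid α} {N : Matroid β}
    (h : IsIsoMap f M N) : ∃ g : β → α, IsIsoMap g N M := by
  have hinv := h.1.invOn_invFunOn
  have hb : Set.BijOn (Function.invFunOn f M.E) N.E M.E := (Set.bijOn_comm hinv).2 h.1
  refine ⟨Function.invFunOn f M.E, hb, fun I hI => ?_⟩
  rw [h.2 _ ((Set.image_mono hI).trans hb.image_eq.subset)]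
  rw [hinv.2.image_image' hI]

theorem IsIsoMap.eq_map {f : α → β} {M : Matroid α} {N : Matroid β} (h : IsIsoMap f M N) :
    N = M.map f h.1.injOn := by
  refine Matroid.ext_indep (by simp [h.1.image_eq]) fun I hI => ?_
  rw [← h.1.image_eq] at hI
  obtain ⟨J, hJ, rfl⟩ := Set.subset_image_iff.1 hI
  rw [Matroid.map_image_indep_iff hJ, h.2 J hJ]

theorem isIsoMap_map {f : α → β} {M : Matroid α} (hf : Set.InjOn f M.E) :
    IsIsoMap f M (M.map f hf) :=
  ⟨hf.bijOn_image, fun _ hI => (Matroid.map_image_indep_iff hI).symm⟩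

theorem IsIsoMap.dual {f : α → β} {M : Matroid α} {N : Matroid β} (h : IsIsoMap f M N) :
    IsIsoMap f (M.dual) (N.dual) := by
  have h1 := isIsoMap_map (M := M.dual) (f := f) h.1.injOn
  rwa [← Matroid.map_dual (hf := h.1.injOn), ← h.eq_map] at h1

theorem IsIsoMap.restrict {f : α → β} {M : Matroid α} {N : Matroid β} (h : IsIsoMap f M N)
    {A : Set α} (hA : A ⊆ M.E) : IsIsoMap f (M.restrict A) (N.restrict (f '' A)) := by
  refine ⟨(h.1.injOn.mono hA).bijOn_image, fun I hI => ?_⟩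
  have hI' : I ⊆ A := hI
  rw [Matroid.restrict_indep_iff, Matroid.restrict_indep_iff, h.2 I (hI'.trans hA)]
  simp [hI', Set.image_mono hI']

theorem IsIsoMap.contract {f : α → β} {M : Matroid α} {N : Matroid β} (h : IsIsoMap f M N)
    {A : Set α} (hA : A ⊆ M.E) : IsIsoMap f (M.contract A) (N.contract (f '' A)) := by
  have h1 := (h.dual.restrict (A := M.E \ A) Set.sdiff_subset).dual
  have e : f '' (M.E \ A) = N.E \ f '' A := by
    rw [h.1.injOn.image_sdiff_subset hA, h.1.image_eq]
  rw [e] at h1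
  exact h1

theorem IsIsoMap.rk_image {f : α → β} {M : Matroid α} {N : Matroid β} (h : IsIsoMap f M N)
    {A : Set α} (hA : A ⊆ M.E) : rk N (f '' A) = rk M A := by
  unfold rk
  obtain ⟨I, hI⟩ := M.exists_isBasis A hA
  have h2 : N.IsBasis (f '' I) (f '' A) := by
    rw [h.eq_map]
    exact hI.map _
  rw [← hI.encard_eq_eRk, ← h2.encard_eq_eRk,
    (h.1.injOn.mono (hI.subset.trans hA)).encard_image]

theorem IsIsoMap.freeProduct {α' β' : Type*} {f : α → α'} {g : β → β'} {M : Matroid α}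
    {M' : Matroid α'} {N : Matroid β} {N' : Matroid β'} [M.Finite] [M'.Finite] [N.Finite]
    [N'.Finite] (h : IsIsoMap f M M') (h' : IsIsoMap g N N') :
    IsIsoMap (Sum.map f g) (freeProduct M N) (freeProduct M' N') := by
  constructor
  · rw [freeProduct_ground, freeProduct_ground]
    refine ⟨?_, ?_, ?_⟩
    · rintro _ (⟨a, ha, rfl⟩ | ⟨a, ha, rfl⟩)
      · exact Or.inl ⟨f a, h.1.mapsTo ha, rfl⟩
      · exact Or.inr ⟨g a, h'.1.mapsTo ha, rfl⟩
    · rintro _ (⟨a, ha, rfl⟩ | ⟨a, ha, rfl⟩) _ (⟨b, hb, rfl⟩ | ⟨b, hb, rfl⟩) hab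
      · simp only [Sum.map_inl, Sum.inl.injEq] at hab
        rw [h.1.injOn ha hb hab]
      · simp at hab
      · simp at hab
      · simp only [Sum.map_inr, Sum.inr.injEq] at hab
        rw [h'.1.injOn ha hb hab]
    · rintro _ (⟨a, ha, rfl⟩ | ⟨a, ha, rfl⟩)
      · obtain ⟨b, hb, rfl⟩ := h.1.surjOn ha
        exact ⟨Sum.inl b, Or.inl ⟨b, hb, rfl⟩, rfl⟩
      · obtain ⟨b, hb, rfl⟩ := h'.1.surjOn ha
        exact ⟨Sum.inr b, Or.inr ⟨b, hb, rfl⟩, rfl⟩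
  · intro I hI
    rw [freeProduct_ground] at hI
    have e1 : (Sum.inl ⁻¹' (Sum.map f g '' I) : Set α') = f '' (Sum.inl ⁻¹' I) := by
      ext x
      constructor
      · rintro ⟨a | a, ha, hx⟩
        · exact ⟨a, ha, by simpa using hx⟩
        · simp at hx
      · rintro ⟨a, ha, rfl⟩
        exact ⟨Sum.inl a, ha, rfl⟩
    have e2 : (Sum.inr ⁻¹' (Sum.map f g '' I) : Set β') = g '' (Sum.inr ⁻¹' I) := by
      ext x
      constructor
      · rintro ⟨a | a, ha, hx⟩
        · simp at hx
        · exact ⟨a, ha, by simpa using hx⟩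
      · rintro ⟨a, ha, rfl⟩
        exact ⟨Sum.inr a, ha, rfl⟩
    have s1 : (Sum.inl ⁻¹' I : Set α) ⊆ M.E := by
      intro a ha
      rcases hI ha with ⟨b, hb, hab⟩ | ⟨b, hb, hab⟩
      · cases hab; exact hb
      · cases hab
    have s2 : (Sum.inr ⁻¹' I : Set β) ⊆ N.E := by
      intro a ha
      rcases hI ha with ⟨b, hb, hab⟩ | ⟨b, hb, hab⟩
      · cases hab
      · cases hab; exact hb
    rw [freeProduct_indep_iff, freeProduct_indep_iff]
    unfold FreeProductIndep nullity rankLack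
    rw [e1, e2, h.rk_image s1, h'.rk_image s2, ← h.2 _ s1, ← h.1.image_eq, h.rk_image subset_rfl,
      (h'.1.injOn.mono s2).ncard_image]
    have s3 : g '' (Sum.inr ⁻¹' I) ⊆ N'.E := (Set.image_mono s2).trans h'.1.image_eq.subset
    simp [s2, s3]

end Basic

/-! ### Finite matroids and their isomorphism classes

Every finite matroid is isomorphic to one whose ground set is a finite set of natural numbers,
so isomorphism classes of finite matroids are classes of such matroids. -/

/-- A finite matroid (with ground set a finite subset of `ℕ`). -/
structure FinMatroid where
  /-- the underlying matroid -/
  toMatroid : Matroid ℕ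
  finite : toMatroid.Finite

namespace FinMatroid

instance (M : FinMatroid) : M.toMatroid.Finite := M.finite

/-- The ground set, as a `Finset`. -/
def ground (M : FinMatroid) : Finset ℕ := M.toMatroid.ground_finite.toFinset

theorem coe_ground (M : FinMatroid) : (M.ground : Set ℕ) = M.toMatroid.E := by simp [ground]

theorem ext' {M N : FinMatroid} (h : M.toMatroid = N.toMatroid) : M = N := by
  cases M; cases N; cases h; rfl

instance setoid : Setoid FinMatroid where
  r M N := ∃ f : ℕ → ℕ, IsIsoMap f M.toMatroid N.toMatroid
  iseqv := ⟨fun _ => ⟨id, IsIsoMap.refl _⟩, fun ⟨_, h⟩ => h.exists_symm,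
    fun ⟨_, h⟩ ⟨_, h'⟩ => ⟨_, h.trans h'⟩⟩

/-- The restriction `M|A` of `M` to `A ∩ E(M)`. -/
def restr (M : FinMatroid) (A : Set ℕ) : FinMatroid :=
  ⟨M.toMatroid.restrict (A ∩ M.toMatroid.E),
    ⟨M.toMatroid.ground_finite.subset Set.inter_subset_right⟩⟩

/-- The contraction `M/A`. -/
def contr (M : FinMatroid) (A : Set ℕ) : FinMatroid :=
  ⟨M.toMatroid.contract A, ⟨M.toMatroid.ground_finite.subset (by simp)⟩⟩

/-- The empty matroid. -/
def empty : FinMatroid := ⟨Matroid.emptyOn ℕ, ⟨by simp⟩⟩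

/-- The free product, transported to a matroid on `ℕ` along a bijection `ℕ ⊕ ℕ ≃ ℕ`. -/
def freeProd (M N : FinMatroid) : FinMatroid :=
  ⟨(freeProduct M.toMatroid N.toMatroid).mapEquiv Equiv.natSumNatEquivNat,
    ⟨by
      rw [Matroid.mapEquiv_ground_eq, freeProduct_ground]
      exact ((M.toMatroid.ground_finite.image _).union (N.toMatroid.ground_finite.image _)).image _⟩⟩

theorem isIsoMap_freeProd (M N : FinMatroid) :
    IsIsoMap Equiv.natSumNatEquivNat (freeProduct M.toMatroid N.toMatroid)
      (M.freeProd N).toMatroid :=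
  isIsoMap_map Equiv.natSumNatEquivNat.injective.injOn

end FinMatroid

/-- Isomorphism classes of finite matroids. -/
def MatroidClass : Type := Quotient FinMatroid.setoid

/-- The isomorphism class of a finite matroid. -/
def FinMatroid.cls (M : FinMatroid) : MatroidClass := Quotient.mk _ M

namespace FinMatroid

theorem cls_eq_iff {M N : FinMatroid} :
    M.cls = N.cls ↔ ∃ f : ℕ → ℕ, IsIsoMap f M.toMatroid N.toMatroid := Quotient.eq

theorem cls_restr_image {M N : FinMatroid} {f : ℕ → ℕ} (h : IsIsoMap f M.toMatroid N.toMatroid)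
    {A : Set ℕ} (hA : A ⊆ M.toMatroid.E) : (M.restr A).cls = (N.restr (f '' A)).cls := by
  refine cls_eq_iff.2 ⟨f, ?_⟩
  have h1 := h.restrict hA
  have h2 : f '' A ⊆ N.toMatroid.E := (Set.image_mono hA).trans h.1.image_eq.subset
  simpa [restr, Set.inter_eq_left.2 hA, Set.inter_eq_left.2 h2] using h1

theorem cls_contr_image {M N : FinMatroid} {f : ℕ → ℕ} (h : IsIsoMap f M.toMatroid N.toMatroid)
    {A : Set ℕ} (hA : A ⊆ M.toMatroid.E) : (M.contr A).cls = (N.contr (f '' A)).cls :=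
  cls_eq_iff.2 ⟨f, h.contract hA⟩

theorem cls_eq_empty_iff {M : FinMatroid} : M.cls = empty.cls ↔ M.toMatroid.E = ∅ := by
  constructor
  · intro h
    obtain ⟨f, hf⟩ := cls_eq_iff.1 h
    have := hf.1.image_eq
    simpa [empty] using this
  · intro h
    have : M.toMatroid = Matroid.emptyOn ℕ := Matroid.ground_eq_empty_iff.1 h
    rw [ext' (M := M) (N := empty) this]

end FinMatroid

namespace MatroidClass

/-- The class of the empty matroid. -/
def one : MatroidClass := FinMatroid.empty.cls

/-- The free product of isomorphism classes. -/
def mul (x y : MatroidClass) : MatroidClass :=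
  Quotient.liftOn₂ x y (fun M N => (M.freeProd N).cls) (by
    rintro M N M' N' ⟨f, hf⟩ ⟨g, hg⟩
    obtain ⟨e, he⟩ := (FinMatroid.isIsoMap_freeProd M N).exists_symm
    exact FinMatroid.cls_eq_iff.2
      ⟨_, he.trans ((hf.freeProduct hg).trans (FinMatroid.isIsoMap_freeProd M' N'))⟩)

/-- The free product `M₁ □ ⋯ □ Mₖ` of a sequence of isomorphism classes; the empty product is the
empty matroid. -/
def prod (l : List MatroidClass) : MatroidClass := l.foldr mul one

/-- A nonempty matroid is irreducible if every factorization of it as a free product of matroids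
contains it as a factor. -/
def IsIrred (x : MatroidClass) : Prop :=
  x ≠ one ∧ ∀ l : List MatroidClass, prod l = x → x ∈ l

/-- `l` is a factorization of `x` into irreducible matroids. -/
def IsIrredFactorization (l : List MatroidClass) (x : MatroidClass) : Prop :=
  (∀ y ∈ l, IsIrred y) ∧ prod l = x

open Classical in
/-- The sequence of irreducible factors of `x` (it exists and is unique, since every matroid
factors uniquely, up to isomorphism, as a free product of irreducible matroids). -/
def irredFactors (x : MatroidClass) : List MatroidClass :=
  if h : ∃ l, IsIrredFactorization l x then h.choose else []

end MatroidClass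

/-! ### Multisection coefficients -/

/-- The minor `M(A, B) = (M|B)/A`. -/
def FinMatroid.interval (M : FinMatroid) (A B : Set ℕ) : FinMatroid := (M.restr B).contr A

/-- `∅ = S₀ ⊆ S₁ ⊆ ⋯ ⊆ Sₖ = E(M)` and `M(Sᵢ₋₁, Sᵢ)` is in the class `Nᵢ` for `1 ≤ i ≤ k`. -/
def FinMatroid.IsMultisection (M : FinMatroid) (l : List MatroidClass)
    (s : Fin (l.length + 1) → Set ℕ) : Prop :=
  s 0 = ∅ ∧ s (Fin.last _) = M.toMatroid.E ∧ Monotone s ∧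
    ∀ i : Fin l.length, (M.interval (s i.castSucc) (s i.succ)).cls = l.get i

/-- The number of multisections of `M` of type `l`. -/
def FinMatroid.multisection (M : FinMatroid) (l : List MatroidClass) : ℕ :=
  Nat.card {s : Fin (l.length + 1) → Set ℕ // M.IsMultisection l s}

namespace FinMatroid

theorem IsMultisection.subset_ground {M : FinMatroid} {l : List MatroidClass}
    {s : Fin (l.length + 1) → Set ℕ} (h : M.IsMultisection l s) (i : Fin (l.length + 1)) :
    s i ⊆ M.toMatroid.E := by
  rw [← h.2.1]
  exact h.2.2.1 (Fin.le_last i)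

instance (M : FinMatroid) (l : List MatroidClass) :
    Finite {s : Fin (l.length + 1) → Set ℕ // M.IsMultisection l s} := by
  have hf : (Set.powerset M.toMatroid.E).Finite := M.toMatroid.ground_finite.finite_subsets
  have : Finite (Set.powerset M.toMatroid.E) := hf
  exact Finite.of_injective
    (fun (s : {s : Fin (l.length + 1) → Set ℕ // M.IsMultisection l s}) (i : Fin (l.length + 1)) =>
      (⟨s.1 i, s.2.subset_ground i⟩ : Set.powerset M.toMatroid.E)) (by
    intro s t hst
    ext i : 2
    exact congrArg Subtype.val (congrFun hst i))

theorem cls_interval_image {M N : FinMatroid} {f : ℕ → ℕ}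
    (h : IsIsoMap f M.toMatroid N.toMatroid) {A B : Set ℕ} (hAB : A ⊆ B)
    (hB : B ⊆ M.toMatroid.E) :
    (M.interval A B).cls = (N.interval (f '' A) (f '' B)).cls := by
  refine cls_eq_iff.2 ⟨f, ?_⟩
  have h1 := (h.restrict hB).contract (A := A) hAB
  have h2 : f '' B ⊆ N.toMatroid.E := (Set.image_mono hB).trans h.1.image_eq.subset
  simpa [interval, contr, restr, Set.inter_eq_left.2 hB, Set.inter_eq_left.2 h2] using h1

theorem multisection_le {M N : FinMatroid} {f : ℕ → ℕ}
    (h : IsIsoMap f M.toMatroid N.toMatroid) (l : List MatroidClass) :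
    M.multisection l ≤ N.multisection l := by
  refine Nat.card_le_card_of_injective
    (fun s : {s : Fin (l.length + 1) → Set ℕ // M.IsMultisection l s} =>
      (⟨fun i => f '' s.1 i, ?_⟩ :
        {s : Fin (l.length + 1) → Set ℕ // N.IsMultisection l s})) ?_
  · refine ⟨by simp [s.2.1], by simp [s.2.2.1, h.1.image_eq],
      fun i j hij => Set.image_mono (s.2.2.2.1 hij), fun i => ?_⟩
    rw [← s.2.2.2.2 i]
    exact (cls_interval_image h (s.2.2.2.1 (Fin.castSucc_le_succ i)) (s.2.subset_ground _)).symm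
  · intro s t hst
    ext i : 2
    have : f '' s.1 i = f '' t.1 i := congrFun (congrArg Subtype.val hst) i
    exact (h.1.injOn.image_eq_image_iff (s.2.subset_ground i) (t.2.subset_ground i)).1 this

end FinMatroid

/-- The multisection coefficient: the number of sequences `∅ = S₀ ⊆ ⋯ ⊆ Sₖ = S` such that the
minor `M(Sᵢ₋₁, Sᵢ)` is isomorphic to `Nᵢ` for `1 ≤ i ≤ k`, where `M = M(S)` is in the class `x`
and `l = [N₁, …, Nₖ]`. -/
def MatroidClass.multisection (x : MatroidClass) (l : List MatroidClass) : ℕ :=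
  Quotient.liftOn x (fun M => M.multisection l) (by
    rintro M N ⟨f, hf⟩
    obtain ⟨g, hg⟩ := hf.exists_symm
    exact le_antisymm (FinMatroid.multisection_le hf l) (FinMatroid.multisection_le hg l))

/-- `c(N, M)`: the multisection coefficient of `N` with respect to the sequence of irreducible
factors of `M`. -/
def MatroidClass.c (N M : MatroidClass) : ℕ := N.multisection M.irredFactors

/-! ### Minor-closed families and the minor coalgebra -/

/-- A nonempty family of (isomorphism classes of) finite matroids closed under minors. -/
structure MinorClosedFamily where
  /-- the isomorphism classes in the family -/
  carrier : Set MatroidClass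
  nonempty : carrier.Nonempty
  minor_mem : ∀ M N : FinMatroid, N.toMatroid.IsMinor M.toMatroid →
    M.cls ∈ carrier → N.cls ∈ carrier

namespace MinorClosedFamily

variable (F : MinorClosedFamily)

/-- The family is closed under free products. -/
def FreeProductClosed : Prop :=
  ∀ x ∈ F.carrier, ∀ y ∈ F.carrier, x.mul y ∈ F.carrier

/-- The (isomorphism classes of) irreducible matroids belonging to the family. -/
def Irr : Type := {x : F.carrier // x.1.IsIrred}

theorem restr_mem {M : FinMatroid} (hM : M.cls ∈ F.carrier) (A : Set ℕ) :
    (M.restr A).cls ∈ F.carrier :=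
  F.minor_mem M _ ⟨∅, M.toMatroid.E \ (A ∩ M.toMatroid.E), by
    have h : M.toMatroid.E \ (M.toMatroid.E \ (A ∩ M.toMatroid.E)) = A ∩ M.toMatroid.E :=
      Set.sdiff_sdiff_cancel_left Set.inter_subset_right
    rw [Matroid.contract_empty, Matroid.delete, h, FinMatroid.restr]⟩ hM

theorem contr_mem {M : FinMatroid} (hM : M.cls ∈ F.carrier) (A : Set ℕ) :
    (M.contr A).cls ∈ F.carrier :=
  F.minor_mem M _ ⟨A, ∅, by simp [FinMatroid.contr]⟩ hM

theorem one_mem : MatroidClass.one ∈ F.carrier := by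
  obtain ⟨x, hx⟩ := F.nonempty
  induction x using Quotient.inductionOn with
  | h M =>
    have h := F.restr_mem (M := M) hx ∅
    rwa [FinMatroid.cls_eq_empty_iff.2] at h
    simp [FinMatroid.restr]

end MinorClosedFamily

variable (K : Type u) [Field K]

/-- The minor coalgebra: the free module on the isomorphism classes in the family. (A separate
name, so that it does not receive another coalgebra structure on finitely supported functions.) -/
def MinorCoalgebra (F : MinorClosedFamily) : Type u := F.carrier →₀ K

namespace MinorCoalgebra

variable (F : MinorClosedFamily)

instance : AddCommGroup (MinorCoalgebra K F) := inferInstanceAs (AddCommGroup (F.carrier →₀ K))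

instance : Module K (MinorCoalgebra K F) := inferInstanceAs (Module K (F.carrier →₀ K))

/-- The basis of isomorphism classes. -/
def classBasis : Module.Basis F.carrier K (MinorCoalgebra K F) :=
  Module.Basis.ofRepr (LinearEquiv.refl K (F.carrier →₀ K))

/-- The basis element of a matroid in the family. -/
def of (M : FinMatroid) (hM : M.cls ∈ F.carrier) : MinorCoalgebra K F :=
  classBasis K F ⟨M.cls, hM⟩

/-- `∑_{A ⊆ S} M|A ⊗ M/A`. -/
def delta (M : FinMatroid) (hM : M.cls ∈ F.carrier) :
    MinorCoalgebra K F ⊗[K] MinorCoalgebra K F :=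
  ∑ A ∈ M.ground.powerset,
    of K F (M.restr A) (F.restr_mem hM A) ⊗ₜ[K] of K F (M.contr A) (F.contr_mem hM A)

variable {F} in
theorem of_congr {M N : FinMatroid} (h : M.cls = N.cls) (hM : M.cls ∈ F.carrier)
    (hN : N.cls ∈ F.carrier) : of K F M hM = of K F N hN := by
  unfold of
  congr 2

variable {F} in
theorem delta_congr {M N : FinMatroid} (h : M.cls = N.cls) (hM : M.cls ∈ F.carrier)
    (hN : N.cls ∈ F.carrier) : delta K F M hM = delta K F N hN := by
  obtain ⟨f, hf⟩ := FinMatroid.cls_eq_iff.1 h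
  unfold delta
  refine Finset.sum_bij (fun A _ => A.image f) ?_ ?_ ?_ ?_
  · intro A hA
    rw [Finset.mem_powerset, ← Finset.coe_subset, FinMatroid.coe_ground] at hA ⊢
    rw [Finset.coe_image]
    exact (Set.image_mono hA).trans hf.1.image_eq.subset
  · intro A hA B hB hAB
    rw [Finset.mem_powerset, ← Finset.coe_subset, FinMatroid.coe_ground] at hA hB
    have := congrArg (fun s : Finset ℕ => (s : Set ℕ)) hAB
    simp only [Finset.coe_image] at this
    exact Finset.coe_injective ((hf.1.injOn.image_eq_image_iff hA hB).1 this)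
  · intro B hB
    rw [Finset.mem_powerset, ← Finset.coe_subset, FinMatroid.coe_ground, ← hf.1.image_eq] at hB
    obtain ⟨A, hA, hAB⟩ := Finset.subset_set_image_iff.1 hB
    refine ⟨A, ?_, hAB⟩
    rwa [Finset.mem_powerset, ← Finset.coe_subset, FinMatroid.coe_ground]
  · intro A hA
    rw [Finset.mem_powerset, ← Finset.coe_subset, FinMatroid.coe_ground] at hA
    congr 1
    · refine of_congr K ?_ _ _
      rw [Finset.coe_image]
      exact FinMatroid.cls_restr_image hf hA
    · refine of_congr K ?_ _ _
      rw [Finset.coe_image]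
      exact FinMatroid.cls_contr_image hf hA

theorem out_mem (x : F.carrier) : (FinMatroid.cls (Quotient.out x.1)) ∈ F.carrier := by
  have : FinMatroid.cls (Quotient.out x.1) = x.1 := Quotient.out_eq x.1
  rw [this]; exact x.2

/-- The restriction-contraction coproduct. -/
def comul : MinorCoalgebra K F →ₗ[K] MinorCoalgebra K F ⊗[K] MinorCoalgebra K F :=
  (classBasis K F).constr K fun x => delta K F (Quotient.out x.1) (out_mem F x)

open Classical in
/-- The counit: `1` on the empty matroid and `0` on all other matroids. -/
def counit : MinorCoalgebra K F →ₗ[K] K :=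
  (classBasis K F).constr K fun x => if x.1 = MatroidClass.one then 1 else 0

theorem comul_of (M : FinMatroid) (hM : M.cls ∈ F.carrier) :
    comul K F (of K F M hM) = delta K F M hM := by
  unfold comul of
  rw [Module.Basis.constr_basis]
  exact delta_congr K (Quotient.out_eq M.cls) _ _

open Classical in
theorem counit_of (M : FinMatroid) (hM : M.cls ∈ F.carrier) :
    counit K F (of K F M hM) = if M.ground = ∅ then 1 else 0 := by
  unfold counit of
  rw [Module.Basis.constr_basis]
  have : (M.cls = MatroidClass.one) ↔ M.ground = ∅ := by
    rw [← Finset.coe_eq_empty, FinMatroid.coe_ground]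
    exact FinMatroid.cls_eq_empty_iff
  simp only [this]

theorem exists_of (x : F.carrier) : ∃ M, ∃ hM : M.cls ∈ F.carrier,
    classBasis K F x = of K F M hM := by
  obtain ⟨x, hx⟩ := x
  induction x using Quotient.inductionOn with
  | h M => exact ⟨M, hx, rfl⟩

theorem ground_restr (M : FinMatroid) {A : Finset ℕ} (hA : A ⊆ M.ground) :
    (M.restr A).ground = A := by
  rw [← Finset.coe_inj, FinMatroid.coe_ground]
  rw [← Finset.coe_subset, FinMatroid.coe_ground] at hA
  simpa [FinMatroid.restr] using hA

theorem ground_contr (M : FinMatroid) (A : Finset ℕ) : (M.contr A).ground = M.ground \ A := by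
  rw [← Finset.coe_inj, FinMatroid.coe_ground, Finset.coe_sdiff, FinMatroid.coe_ground]
  rfl

theorem restr_restr (M : FinMatroid) {A B : Finset ℕ} (hBA : B ⊆ A) (hA : A ⊆ M.ground) :
    (M.restr A).restr B = M.restr B := by
  rw [← Finset.coe_subset, FinMatroid.coe_ground] at hA
  rw [← Finset.coe_subset] at hBA
  apply FinMatroid.ext'
  simp only [FinMatroid.restr, Matroid.restrict_ground_eq]
  rw [Set.inter_eq_left.2 hA, Set.inter_eq_left.2 hBA, Set.inter_eq_left.2 (hBA.trans hA),
    Matroid.restrict_restrict_eq _ hBA]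

theorem contr_restr (M : FinMatroid) {B C : Finset ℕ} (hB : B ⊆ M.ground)
    (hC : C ⊆ M.ground \ B) : (M.contr B).restr C = (M.restr ↑(B ∪ C)).contr B := by
  have hd : Disjoint (B : Set ℕ) (C : Set ℕ) := by
    rw [Finset.disjoint_coe]
    exact Finset.disjoint_of_subset_right hC Finset.disjoint_sdiff
  rw [← Finset.coe_subset, Finset.coe_sdiff, FinMatroid.coe_ground] at hC
  rw [← Finset.coe_subset, FinMatroid.coe_ground] at hB
  apply FinMatroid.ext'
  simp only [FinMatroid.restr, FinMatroid.contr, Matroid.contract_ground, Finset.coe_union]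
  rw [Set.inter_eq_left.2 hC,
    Set.inter_eq_left.2 (Set.union_subset hB (hC.trans Set.sdiff_subset)),
    Matroid.contract_restrict_eq_restrict_contract _ hd, Set.union_comm]

theorem contr_contr (M : FinMatroid) (B C : Finset ℕ) :
    (M.contr B).contr C = M.contr ↑(B ∪ C) := by
  apply FinMatroid.ext'
  simp [FinMatroid.contr, Matroid.contract_contract]

instance : Coalgebra K (MinorCoalgebra K F) where
  comul := comul K F
  counit := counit K F
  coassoc := by
    refine (classBasis K F).ext fun x => ?_
    obtain ⟨M, hM, hx⟩ := exists_of K F x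
    simp only [hx, LinearMap.comp_apply, LinearEquiv.coe_coe, comul_of]
    unfold delta
    simp only [map_sum, LinearMap.rTensor_tmul, LinearMap.lTensor_tmul, comul_of]
    unfold delta
    simp only [TensorProduct.sum_tmul, TensorProduct.tmul_sum, map_sum, TensorProduct.assoc_tmul]
    rw [Finset.sum_sigma', Finset.sum_sigma']
    refine Finset.sum_bij' (fun p _ => ⟨p.2, p.1 \ p.2⟩) (fun p _ => ⟨p.1 ∪ p.2, p.1⟩) ?_ ?_ ?_ ?_ ?_
    · rintro ⟨A, B⟩ h
      simp only [Finset.mem_sigma, Finset.mem_powerset] at h ⊢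
      obtain ⟨hA, hB⟩ := h
      rw [ground_restr M hA] at hB
      rw [ground_contr]
      exact ⟨hB.trans hA, Finset.sdiff_subset_sdiff hA subset_rfl⟩
    · rintro ⟨B, C⟩ h
      simp only [Finset.mem_sigma, Finset.mem_powerset] at h ⊢
      obtain ⟨hB, hC⟩ := h
      rw [ground_contr] at hC
      have hu : B ∪ C ⊆ M.ground := Finset.union_subset hB (hC.trans Finset.sdiff_subset)
      rw [ground_restr M hu]
      exact ⟨hu, Finset.subset_union_left⟩
    · rintro ⟨A, B⟩ h
      simp only [Finset.mem_sigma, Finset.mem_powerset] at h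
      obtain ⟨hA, hB⟩ := h
      rw [ground_restr M hA] at hB
      simp [Finset.union_sdiff_of_subset hB]
    · rintro ⟨B, C⟩ h
      simp only [Finset.mem_sigma, Finset.mem_powerset] at h
      obtain ⟨hB, hC⟩ := h
      rw [ground_contr] at hC
      have hd : Disjoint B C := Finset.disjoint_of_subset_right hC Finset.disjoint_sdiff
      simp [Finset.union_sdiff_cancel_left hd]
    · rintro ⟨A, B⟩ h
      simp only [Finset.mem_sigma, Finset.mem_powerset] at h
      obtain ⟨hA, hB⟩ := h
      rw [ground_restr M hA] at hB
      have hu : B ∪ (A \ B) = A := Finset.union_sdiff_of_subset hB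
      refine congrArg₂ _ (of_congr K ?_ _ _)
        (congrArg₂ _ (of_congr K ?_ _ _) (of_congr K ?_ _ _))
      · rw [restr_restr M hB hA]
      · rw [contr_restr M (hB.trans hA) (Finset.sdiff_subset_sdiff hA subset_rfl), hu]
      · rw [contr_contr, hu]
  rTensor_counit_comp_comul := by
    refine (classBasis K F).ext fun x => ?_
    obtain ⟨M, hM, hx⟩ := exists_of K F x
    simp only [hx, LinearMap.comp_apply, comul_of, TensorProduct.mk_apply]
    unfold delta
    simp only [map_sum, LinearMap.rTensor_tmul, counit_of]
    rw [Finset.sum_eq_single ∅]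
    · rw [ground_restr M (Finset.empty_subset _), if_pos rfl]
      refine congrArg₂ _ rfl (of_congr K ?_ _ _)
      congr 1
      apply FinMatroid.ext'
      simp [FinMatroid.contr]
    · intro A hA hne
      rw [ground_restr M (Finset.mem_powerset.1 hA), if_neg hne, TensorProduct.zero_tmul]
    · intro h
      exact absurd (Finset.empty_mem_powerset _) h
  lTensor_counit_comp_comul := by
    refine (classBasis K F).ext fun x => ?_
    obtain ⟨M, hM, hx⟩ := exists_of K F x
    simp only [hx, LinearMap.comp_apply, comul_of, LinearMap.flip_apply, TensorProduct.mk_apply]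
    unfold delta
    simp only [map_sum, LinearMap.lTensor_tmul, counit_of]
    rw [Finset.sum_eq_single M.ground]
    · rw [ground_contr, Finset.sdiff_self, if_pos rfl]
      refine congrArg₂ _ (of_congr K ?_ _ _) rfl
      congr 1
      apply FinMatroid.ext'
      simp [FinMatroid.restr, FinMatroid.coe_ground]
    · intro A hA hne
      rw [ground_contr, if_neg, TensorProduct.tmul_zero]
      rw [Finset.sdiff_eq_empty_iff_subset]
      exact fun h => hne (subset_antisymm (Finset.mem_powerset.1 hA) h)
    · intro h
      exact absurd (Finset.mem_powerset_self _) h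

/-- The empty matroid, as an element of the minor coalgebra. -/
def emptyElem : MinorCoalgebra K F := classBasis K F ⟨MatroidClass.one, F.one_mem⟩

/-- The pairing with `P_M = ∑_N c(N, M) N`, the product of the irreducible factors of `M` in the
minor algebra, where distinct isomorphism classes are orthonormal: `N ↦ c(N, M)`. -/
def pairP (M : F.carrier) : MinorCoalgebra K F →ₗ[K] K :=
  (classBasis K F).constr K fun N => (MatroidClass.c N.1 M.1 : K)

open Classical in
/-- `⟨Q_M, P_N⟩ = δ_{M,N}` for all `M`, `N` in the family. -/
def IsDualToP (Q : F.carrier → MinorCoalgebra K F) : Prop :=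
  ∀ M N : F.carrier, pairP K F N (Q M) = if M = N then 1 else 0

end MinorCoalgebra

/-! ### Connected and cofree coalgebras, primitive elements -/

section Coalg

variable (C : Type v) [AddCommGroup C] [Module K C] [Coalgebra K C]

variable {C} in
/-- The subspace of primitive elements of `C` with respect to the group-like element `g`:
`Δ x = x ⊗ g + g ⊗ x`. -/
def primitives (g : C) : Submodule K C :=
  LinearMap.eqLocus (Coalgebra.comul (R := K) (A := C))
    ((TensorProduct.mk K C C).flip g + TensorProduct.mk K C C g)

variable {C} in
/-- The filtration `F₀ ⊆ F₁ ⊆ ⋯` generated by a group-like element `g`: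
`F₀ = K g` and `Fₙ₊₁ = Δ⁻¹ (Fₙ ⊗ C + C ⊗ F₀)`. -/
def connFiltration (g : C) : ℕ → Submodule K C
  | 0 => K ∙ g
  | n + 1 => Submodule.comap (Coalgebra.comul (R := K) (A := C))
      (Submodule.map₂ (TensorProduct.mk K C C) (connFiltration g n) ⊤ ⊔
        Submodule.map₂ (TensorProduct.mk K C C) ⊤ (K ∙ g))

variable {C} in
/-- `C` is a connected (conilpotent) coalgebra with group-like element `g`. -/
structure IsConnected (g : C) : Prop where
  isGroupLike : IsGroupLikeElem K g
  exhaustive : ∀ x : C, ∃ n, x ∈ connFiltration K g n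

variable {C} in
/-- The connected coalgebra `C` (with group-like element `g`) is cofree, cogenerated by `V`, with
projection `p : C → V`: for every connected coalgebra `D` with group-like element `d`, each linear
map `D → V` which vanishes on `d` factors uniquely as `p` after a morphism of connected coalgebras
`D → C`. -/
structure IsCofreeOn {V : Type v'} [AddCommGroup V] [Module K V] (g : C) (p : C →ₗ[K] V) : Prop where
  isConnected : IsConnected K g
  map_groupLike : p g = 0
  existsUnique_lift : ∀ (D : Type w) [AddCommGroup D] [Module K D] [Coalgebra K D] (d : D),
    IsConnected K d → ∀ f : D →ₗ[K] V, f d = 0 →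
      ∃! φ : D →ₗc[K] C, φ d = g ∧ p ∘ₗ (φ : D →ₗ[K] C) = f

end Coalg

end FreeProd

end

open FreeProd

/-! The functionals `x ↦ ⟨x, P_M⟩` multiply under convolution as words in irreducible matroids
multiply under concatenation. The family dual to them is therefore a basis on which the coproduct is
deconcatenation, and a coalgebra of this kind is cofree on its letters.

Multiplicativity: a multisection of type `x :: l` consists of a first set `A` with `M|A ≅ x` and a
multisection of `M/A` of type `l` (`multisection_cons`). Summing over `A` is evaluating a
convolution product on `δ(M)` (`multisectionForm_cons`).

Words: a factorization into two factors is the same as a free separator, a set `A` such that every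
circuit lies in `A` or spans it (`cls_eq_mul`, `exists_freeSeparator`). Free separators are closed
under intersection. Two irreducible initial separators are equal or are singletons of the same rank,
which yields left cancellation (`mul_cancel_of_isIrred`) and unique factorization. Since factors are
minors, the family is in bijection with the words in its irreducible members (`wordEquiv`).

Duality: the identity `M → M|A □ M/A` preserves independence, so the free product is the freest
matroid with a given multisection type. Hence `c(N, M) ≠ 0` forces equal sizes, and either `N = M`
or `N` has fewer independent sets (`of_c_ne_zero`), while `c(M, M) ≠ 0`. With finitely many matroids
of each size, the matrix `c` is block diagonal with finite triangular blocks, invertible in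
characteristic zero (`pairing_bijective`); its inverse gives the `Q_M`.

Conclusion: for a basis with these dual coordinates, a linear map `f` from a connected coalgebra
lifts by taking the convolution product of the coordinates of `f` along each word (`isCofreeOn`),
and the primitive elements are spanned by the one-letter words (`span_eq_primitives`). -/

namespace FreeProd

/-! ### Coalgebras with a deconcatenation basis: connectedness, cofreeness, primitive elements. -/

section Deconcatenation

open Coalgebra WithConv

variable {K : Type u} [Field K] {C : Type v} [AddCommGroup C] [Module K C] [Coalgebra K C]
  {D : Type w} [AddCommGroup D] [Module K D] [Coalgebra K D] {I : Type v'}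

/-- A basis of a coalgebra indexed by words is a deconcatenation basis if the dual coordinates
multiply under convolution as the words do under concatenation. -/
structure IsDeconcatenation (B : Module.Basis (List I) K C) : Prop where
  nil : toConv (B.coord []) = 1
  cons : ∀ i w, toConv (B.coord (i :: w)) = toConv (B.coord [i]) * toConv (B.coord w)

theorem tensorProduct_repr_apply {K : Type u} [Field K] {C : Type v} [AddCommGroup C] [Module K C]
    {ι : Type*} (B : Module.Basis ι K C) (i j : ι) (t : C ⊗[K] C) :
    (B.tensorProduct B).repr t (i, j) =
      LinearMap.mul' K K (TensorProduct.map (B.coord i) (B.coord j) t) := by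
  induction t with
  | zero => simp
  | add x y hx hy => simp [hx, hy]
  | tmul x y => simp [Module.Basis.tensorProduct_repr_tmul_apply, mul_comm]

/-- Reduces an identity in `C ⊗ C` to scalar identities of the shape that convolution products
produce. -/
theorem tensor_ext_coord {K : Type u} [Field K] {C : Type v} [AddCommGroup C] [Module K C]
    {ι : Type*} (B : Module.Basis ι K C) {t t' : C ⊗[K] C}
    (h : ∀ i j, LinearMap.mul' K K (TensorProduct.map (B.coord i) (B.coord j) t) =
      LinearMap.mul' K K (TensorProduct.map (B.coord i) (B.coord j) t')) : t = t' := by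
  refine (B.tensorProduct B).ext_elem ?_
  rintro ⟨i, j⟩
  rw [tensorProduct_repr_apply, tensorProduct_repr_apply, h]

theorem connFiltration_le_succ {g : C} (n : ℕ) (hg : IsGroupLikeElem K g) :
    connFiltration K g n ≤ connFiltration K g (n + 1) := by
  induction n with
  | zero =>
    simp only [connFiltration]
    rw [Submodule.span_singleton_le_iff_mem, Submodule.mem_comap, hg.comul_eq_tmul_self]
    exact Submodule.mem_sup_right
      (Submodule.apply_mem_map₂ _ trivial (Submodule.mem_span_singleton_self g))
  | succ n ih =>
    exact Submodule.comap_mono (sup_le_sup_right (Submodule.map₂_le_map₂_left ih) _)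

theorem connFiltration_mono {g : C} (hg : IsGroupLikeElem K g) : Monotone (connFiltration K g) :=
  monotone_nat_of_le_succ fun n => connFiltration_le_succ n hg

namespace IsDeconcatenation

variable {B : Module.Basis (List I) K C} (hB : IsDeconcatenation B)

include hB

theorem append (u v : List I) :
    toConv (B.coord (u ++ v)) = toConv (B.coord u) * toConv (B.coord v) := by
  induction u with
  | nil => rw [List.nil_append, hB.nil, one_mul]
  | cons i u ih => rw [List.cons_append, hB.cons, ih, hB.cons i u, mul_assoc]

/-- The coordinate form of `Δ (B w) = ∑ B u ⊗ B v`, summed over the splittings `w = u ++ v`. -/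
theorem mul'_map_comul (u v : List I) (x : C) :
    LinearMap.mul' K K (TensorProduct.map (B.coord u) (B.coord v) (comul x)) =
      B.coord (u ++ v) x :=
  (congrArg (fun f => f.ofConv x) (hB.append u v)).symm

theorem counit_eq (x : C) : counit (R := K) x = B.coord [] x :=
  (congrArg (fun f => f.ofConv x) hB.nil).symm

theorem isGroupLike : IsGroupLikeElem K (B []) where
  counit_eq_one := by simp [hB.counit_eq]
  comul_eq_tmul_self := by
    refine tensor_ext_coord B fun u v => ?_
    rw [hB.mul'_map_comul]
    cases u <;> simp [Finsupp.single_apply]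

/-- In a term `B u ⊗ B v` of the coproduct with `u ++ v = w`, either `v` is empty and the term lies
in `C ⊗ F₀`, or `u` is shorter than `w` and induction applies to it. -/
theorem mem_connFiltration (w : List I) : B w ∈ connFiltration K (B []) w.length := by
  induction h : w.length using Nat.strong_induction_on generalizing w with
  | _ n ih =>
    obtain rfl | n := n
    · rw [List.length_eq_zero_iff.1 h]
      exact Submodule.mem_span_singleton_self _
    · simp only [connFiltration, Submodule.mem_comap]
      rw [← (B.tensorProduct B).linearCombination_repr (comul (B w))]
      refine Submodule.sum_mem _ fun p hp => Submodule.smul_mem _ _ ?_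
      obtain ⟨u, v⟩ := p
      rw [Finsupp.mem_support_iff, tensorProduct_repr_apply, hB.mul'_map_comul] at hp
      have hw : w = u ++ v := by
        by_contra hne
        exact hp (by simp [hne])
      rw [Module.Basis.tensorProduct_apply]
      obtain rfl | hv := eq_or_ne v []
      · exact Submodule.mem_sup_right
          (Submodule.apply_mem_map₂ _ trivial (Submodule.mem_span_singleton_self _))
      · refine Submodule.mem_sup_left (Submodule.apply_mem_map₂ _ ?_ trivial)
        have hv' := List.length_pos_iff.2 hv
        rw [hw, List.length_append] at h
        exact connFiltration_mono hB.isGroupLike (by omega) (ih u.length (by omega) u rfl)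

theorem isConnected : IsConnected K (B []) where
  isGroupLike := hB.isGroupLike
  exhaustive x := by
    refine ⟨(B.repr x).support.sup List.length, ?_⟩
    suffices h : Finsupp.linearCombination K B (B.repr x) ∈
        connFiltration K (B []) ((B.repr x).support.sup List.length) by
      rwa [B.linearCombination_repr] at h
    exact Submodule.sum_mem _ fun w hw => Submodule.smul_mem _ _
      (connFiltration_mono hB.isGroupLike (Finset.le_sup (f := List.length) hw)
        (hB.mem_connFiltration w))

end IsDeconcatenation

/-- The convolution product, along a word, of the coordinates of a linear map. -/
noncomputable def wordCoord (f : D →ₗ[K] I →₀ K) (w : List I) : WithConv (D →ₗ[K] K) :=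
  (w.map fun i => toConv (Finsupp.lapply i ∘ₗ f)).prod

theorem wordCoord_append (f : D →ₗ[K] I →₀ K) (u v : List I) :
    wordCoord f (u ++ v) = wordCoord f u * wordCoord f v := by
  simp [wordCoord]

theorem wordCoord_cons_apply (f : D →ₗ[K] I →₀ K) (i : I) (w : List I) (x : D) :
    wordCoord f (i :: w) x =
      ∑ j ∈ (ℛ K x).index, f ((ℛ K x).left j) i * wordCoord f w ((ℛ K x).right j) := by
  rw [wordCoord, List.map_cons, List.prod_cons, Coalgebra.Repr.convMul_apply (ℛ K x)]
  rfl

theorem wordCoord_groupLike (f : D →ₗ[K] I →₀ K) {d : D} (hd : IsGroupLikeElem K d)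
    (hf : f d = 0) (i : I) (w : List I) : wordCoord f (i :: w) d = 0 := by
  rw [wordCoord, List.map_cons, List.prod_cons, LinearMap.convMul_apply, hd.comul_eq_tmul_self]
  simp [hf]

/-- The last letter is split off, matching the shape `Fₙ ⊗ D + D ⊗ F₀` of the filtration: the
remaining word kills `Fₙ` by induction, and the last letter kills `d`. -/
theorem wordCoord_eq_zero (f : D →ₗ[K] I →₀ K) {d : D} (hd : IsGroupLikeElem K d)
    (hf : f d = 0) (n : ℕ) : ∀ x ∈ connFiltration K d n, ∀ w : List I, n < w.length →
      wordCoord f w x = 0 := by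
  induction n with
  | zero =>
    intro x hx w hw
    obtain ⟨a, rfl⟩ := Submodule.mem_span_singleton.1 hx
    obtain _ | ⟨i, w⟩ := w
    · simp at hw
    · have := wordCoord_groupLike f hd hf i w
      change (wordCoord f (i :: w)).ofConv (a • d) = 0
      rw [map_smul]
      exact (congrArg (a • ·) this).trans (smul_zero a)
  | succ n ih =>
    intro x hx w hw
    obtain rfl | ⟨u, i, rfl⟩ := w.eq_nil_or_concat'
    · simp at hw
    rw [wordCoord_append, LinearMap.convMul_apply]
    have hle : Submodule.map₂ (TensorProduct.mk K D D) (connFiltration K d n) ⊤ ⊔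
        Submodule.map₂ (TensorProduct.mk K D D) ⊤ (K ∙ d) ≤
        LinearMap.ker (LinearMap.mul' K K ∘ₗ
          TensorProduct.map (wordCoord f u).ofConv (wordCoord f [i]).ofConv) := by
      refine sup_le (Submodule.map₂_le.2 fun y hy z _ => ?_)
        (Submodule.map₂_le.2 fun y _ z hz => ?_)
      · have h := ih y hy u (by simpa using hw)
        change (wordCoord f u).ofConv y = 0 at h
        simp [h]
      · obtain ⟨a, rfl⟩ := Submodule.mem_span_singleton.1 hz
        have h := wordCoord_groupLike f hd hf i []
        change (wordCoord f [i]).ofConv d = 0 at h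
        simp [h]
    exact hle hx

/-- The alphabet may be infinite, so a bound on the length does not suffice. In a finite expression
for `Δ x`, the values of `f` on the left factors involve finitely many first letters, and induction
handles the right factors. -/
theorem finite_wordCoord_length (f : D →ₗ[K] I →₀ K) (n : ℕ) : ∀ x,
    {w : List I | w.length = n ∧ wordCoord f w x ≠ 0}.Finite := by
  induction n with
  | zero =>
    exact fun x => (Set.finite_singleton []).subset fun w hw => List.length_eq_zero_iff.1 hw.1
  | succ n ih =>
    intro x
    have h1 : (⋃ j ∈ (ℛ K x).index, ((f ((ℛ K x).left j)).support : Set I)).Finite :=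
      Set.Finite.biUnion (Finset.finite_toSet _) fun j _ => Finset.finite_toSet _
    have h2 : (⋃ j ∈ (ℛ K x).index, {w : List I | w.length = n ∧
        wordCoord f w ((ℛ K x).right j) ≠ 0}).Finite :=
      Set.Finite.biUnion (Finset.finite_toSet _) fun j _ => ih _
    refine (h1.image2 List.cons h2).subset ?_
    rintro w ⟨hl, hw⟩
    obtain _ | ⟨i, w⟩ := w
    · simp at hl
    rw [wordCoord_cons_apply] at hw
    obtain ⟨j, hj, hne⟩ := Finset.exists_ne_zero_of_sum_ne_zero hw
    refine ⟨i, ?_, w, ?_, rfl⟩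
    · exact Set.mem_biUnion hj (Finsupp.mem_support_iff.2 (left_ne_zero_of_mul hne))
    · exact Set.mem_biUnion hj ⟨by simpa using hl, right_ne_zero_of_mul hne⟩

theorem finite_wordCoord (f : D →ₗ[K] I →₀ K) {d : D} (hd : IsConnected K d) (hf : f d = 0)
    (x : D) : {w : List I | wordCoord f w x ≠ 0}.Finite := by
  obtain ⟨n, hn⟩ := hd.exhaustive x
  refine (Set.Finite.biUnion (Set.finite_Iic n) fun k _ =>
    finite_wordCoord_length f k x).subset fun w hw => ?_
  refine Set.mem_biUnion (x := w.length) ?_ ⟨rfl, hw⟩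
  by_contra h
  exact hw (wordCoord_eq_zero f hd.isGroupLike hf n x hn w (not_le.1 h))

/-- The linear map into the coalgebra with basis `B` with coordinates `wordCoord f`. -/
noncomputable def wordLift {C : Type v} [AddCommGroup C] [Module K C]
    (B : Module.Basis (List I) K C) (f : D →ₗ[K] I →₀ K) {d : D}
    (hd : IsConnected K d) (hf : f d = 0) : D →ₗ[K] C :=
  B.repr.symm.toLinearMap ∘ₗ
    { toFun := fun x =>
        Finsupp.ofSupportFinite (fun w => wordCoord f w x) (finite_wordCoord f hd hf x)
      map_add' := fun x y => by
        ext w; exact (wordCoord f w).ofConv.map_add x y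
      map_smul' := fun a x => by
        ext w; exact (wordCoord f w).ofConv.map_smul a x }

theorem coord_wordLift {C : Type v} [AddCommGroup C] [Module K C]
    (B : Module.Basis (List I) K C) (f : D →ₗ[K] I →₀ K) {d : D}
    (hd : IsConnected K d) (hf : f d = 0) (w : List I) :
    B.coord w ∘ₗ wordLift B f hd hf = (wordCoord f w).ofConv := by
  ext x
  simp only [wordLift, LinearMap.comp_apply, Module.Basis.coord_apply, LinearEquiv.coe_coe,
    LinearEquiv.apply_symm_apply]
  rfl

namespace IsDeconcatenation

variable {B : Module.Basis (List I) K C} (hB : IsDeconcatenation B)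

include hB

/-- The lift respects coproducts because its coordinates multiply under concatenation of words, as
those of `B` do. -/
theorem isCofreeOn (p : C →ₗ[K] I →₀ K) (hp : ∀ x i, p x i = B.coord [i] x) :
    IsCofreeOn.{u, v, max u v', w} K (B []) p where
  isConnected := hB.isConnected
  map_groupLike := by
    ext i
    rw [hp]
    simp
  existsUnique_lift D _ _ _ d hd f hf := by
    have hφ := coord_wordLift B f hd hf
    refine ⟨{ wordLift B f hd hf with
      counit_comp := ?_
      map_comp_comul := ?_ }, ⟨?_, ?_⟩, ?_⟩
    · ext x
      refine (hB.counit_eq _).trans ((LinearMap.congr_fun (hφ []) x).trans ?_)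
      simp [wordCoord, LinearMap.convOne_def]
    · ext x
      refine tensor_ext_coord B fun u v => ?_
      simp only [LinearMap.comp_apply]
      rw [hB.mul'_map_comul, ← LinearMap.comp_apply (TensorProduct.map (B.coord u) (B.coord v)),
        ← TensorProduct.map_comp, ← LinearMap.comp_apply (B.coord (u ++ v)), hφ, hφ, hφ,
        wordCoord_append]
      rfl
    · refine B.ext_elem fun w => (LinearMap.congr_fun (hφ w) d).trans ?_
      obtain _ | ⟨i, w⟩ := w
      · simp [wordCoord, LinearMap.convOne_def, hd.isGroupLike.counit_eq_one]
      · refine (wordCoord_groupLike f hd.isGroupLike hf i w).trans ?_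
        simp
    · ext x i
      refine (hp _ _).trans ((LinearMap.congr_fun (hφ [i]) x).trans ?_)
      simp [wordCoord]
    -- Uniqueness: composing with a coalgebra morphism preserves convolution products, so the
    -- coordinates of `ψ` on one-letter words, fixed by `f`, determine all others.
    · rintro ψ ⟨hψd, hψ⟩
      have hw : ∀ w, toConv (B.coord w ∘ₗ (ψ : D →ₗ[K] C)) = wordCoord f w := by
        intro w
        induction w with
        | nil =>
          have h1 : B.coord [] = counit (R := K) := LinearMap.ext fun x => (hB.counit_eq x).symm
          rw [h1]
          ext x
          simp [wordCoord, LinearMap.convOne_def]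
        | cons i w ih =>
          have h1 : B.coord [i] ∘ₗ (ψ : D →ₗ[K] C) = Finsupp.lapply i ∘ₗ f := by
            ext x
            rw [← hψ]
            exact (hp _ _).symm
          have h2 := LinearMap.convMul_comp_coalgHom_distrib (toConv (B.coord [i]))
            (toConv (B.coord w)) ψ
          rw [← hB.cons] at h2
          change B.coord (i :: w) ∘ₗ (ψ : D →ₗ[K] C) = _ at h2
          rw [h2]
          change toConv (B.coord [i] ∘ₗ (ψ : D →ₗ[K] C)) * toConv (B.coord w ∘ₗ (ψ : D →ₗ[K] C)) = _
          rw [ih, h1]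
          simp [wordCoord]
      ext x
      refine B.ext_elem fun w => ?_
      refine Eq.trans (congrArg (fun g => g.ofConv x) (hw w)) ?_
      exact (LinearMap.congr_fun (hφ w) x).symm

theorem span_eq_primitives :
    Submodule.span K (Set.range fun i : I => B [i]) = primitives K (B []) := by
  -- Primitivity is compared on each pair of coordinates `(u, v)`.
  have hmem : ∀ x, x ∈ primitives K (B []) ↔ ∀ u v, B.coord (u ++ v) x =
      B.coord u x * B.coord v (B []) + B.coord u (B []) * B.coord v x := by
    intro x
    constructor
    · intro hx u v
      rw [← hB.mul'_map_comul]
      have : comul (R := K) x = x ⊗ₜ B [] + B [] ⊗ₜ x := hx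
      rw [this]
      simp
    · intro h
      refine tensor_ext_coord B fun u v => ?_
      rw [hB.mul'_map_comul, h]
      simp
  apply le_antisymm
  · rw [Submodule.span_le]
    rintro _ ⟨i, rfl⟩
    rw [SetLike.mem_coe, hmem]
    intro u v
    simp only [Module.Basis.coord_apply, Module.Basis.repr_self, Finsupp.single_apply]
    obtain _ | ⟨j, u⟩ := u
    · simp
    · obtain _ | ⟨k, v⟩ := v
      · simp
      · simp
  · intro x hx
    rw [hmem] at hx
    rw [← B.linearCombination_repr x]
    refine Submodule.sum_mem _ fun w hw => Submodule.smul_mem _ _ (Submodule.subset_span ?_)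
    rw [Finsupp.mem_support_iff] at hw
    obtain _ | ⟨i, _ | ⟨j, w⟩⟩ := w
    -- The pair of empty words gives `a = a + a`, so the coefficient on the empty word vanishes.
    · have h := hx [] []
      simp at h
      exact absurd h hw
    · exact ⟨i, rfl⟩
    -- Both parts of this splitting are nonempty, so each term on the right contains a vanishing
    -- coordinate of `B []`.
    · have h := hx [i] (j :: w)
      simp at h
      exact absurd h hw

end IsDeconcatenation

end Deconcatenation

/-! ### Ranks and free separators. -/

section Separator

variable {α β : Type*} {M : Matroid α} {A B X : Set α}

theorem natCast_rk (M : Matroid α) [M.Finite] (A : Set α) : ((rk M A).toNat : ℕ∞) = M.eRk A := by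
  rw [rk, Int.toNat_natCast, ENat.natCast_toNat]
  exact ne_top_of_le_ne_top (M.eRank_ne_top_iff.2 inferInstance) (M.eRk_le_eRank A)

theorem rk_nonneg (M : Matroid α) (A : Set α) : 0 ≤ rk M A := Int.natCast_nonneg _

theorem indep_iff_rk [M.Finite] (hX : X ⊆ M.E) : M.Indep X ↔ rk M X = X.ncard := by
  refine ⟨rk_of_indep, fun h => ?_⟩
  have hf := M.ground_finite.subset hX
  rw [M.indep_iff_eRk_eq_encard_of_finite hf, ← natCast_rk, h, Int.toNat_natCast, hf.cast_ncard_eq]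

theorem rk_restrict (h : X ⊆ A) : rk (M.restrict A) X = rk M X := by
  rw [rk, M.restrict_eRk_eq h, rk]

/-- A basis `I` of `A` extends to a basis `J` of `X ∪ A`, and `J \ A` is then a basis of `X` in the
contraction. -/
theorem rk_contract [M.Finite] (hA : A ⊆ M.E) (hX : X ⊆ M.E \ A) :
    rk (M.contract A) X = rk M (X ∪ A) - rk M A := by
  have hXA : X ∪ A ⊆ M.E := Set.union_subset (hX.trans Set.sdiff_subset) hA
  obtain ⟨I, hI⟩ := M.exists_isBasis A hA
  obtain ⟨J, hJ, hIJ⟩ := hI.indep.subset_isBasis_of_subset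
    (hI.subset.trans Set.subset_union_right) hXA
  have hJA : J ∩ A = I := (hI.eq_of_subset_indep (hJ.indep.subset Set.inter_subset_left)
    (Set.subset_inter hIJ hI.subset) Set.inter_subset_right).symm
  have h := hJ.contract_isBasis hI (hJ.indep.subset (Set.union_subset Set.sdiff_subset hIJ))
  have hXe : (X ∪ A) \ A = X := by
    rw [Set.union_sdiff_right]
    exact sdiff_eq_left.2 (Set.disjoint_of_subset_left hX Set.disjoint_sdiff_left)
  rw [hXe] at h
  have hJf : J.Finite := M.ground_finite.subset hJ.indep.subset_ground
  have e := Set.ncard_inter_add_ncard_sdiff_eq_ncard J A hJf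
  rw [hJA] at e
  unfold rk
  rw [← h.encard_eq_eRk, ← hJ.encard_eq_eRk, ← hI.encard_eq_eRk]
  change ((J \ A).ncard : ℤ) = J.ncard - I.ncard
  omega

/-- A set is a free separator of a matroid if every circuit is contained in it or spans it. -/
def IsFreeSeparator (M : Matroid α) (A : Set α) : Prop :=
  ∀ C, M.IsCircuit C → C ⊆ A ∨ A ⊆ M.closure C

theorem isFreeSeparator_empty (M : Matroid α) : IsFreeSeparator M ∅ :=
  fun _ _ => Or.inr (Set.empty_subset _)

theorem isFreeSeparator_ground (M : Matroid α) : IsFreeSeparator M M.E :=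
  fun _ hC => Or.inl hC.subset_ground

theorem IsFreeSeparator.inter (hA : IsFreeSeparator M A) (hB : IsFreeSeparator M B) :
    IsFreeSeparator M (A ∩ B) := by
  intro C hC
  rcases hA C hC with h | h
  · rcases hB C hC with h' | h'
    · exact Or.inl (Set.subset_inter h h')
    · exact Or.inr (Set.inter_subset_right.trans h')
  · exact Or.inr (Set.inter_subset_left.trans h)

theorem IsFreeSeparator.union (hA : IsFreeSeparator M A) (hB : IsFreeSeparator M B) :
    IsFreeSeparator M (A ∪ B) := by
  intro C hC
  rcases hA C hC with h | h
  · exact Or.inl (h.trans Set.subset_union_left)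
  · rcases hB C hC with h' | h'
    · exact Or.inl (h'.trans Set.subset_union_right)
    · exact Or.inr (Set.union_subset h h')

theorem IsFreeSeparator.restrict (hA : IsFreeSeparator M A) (hAB : A ⊆ B) (hB : B ⊆ M.E) :
    IsFreeSeparator (M.restrict B) A := by
  intro C hC
  rw [Matroid.restrict_isCircuit_iff hB] at hC
  rw [M.restrict_closure_eq hC.2 hB]
  exact (hA C hC.1).imp id fun h => Set.subset_inter h hAB

theorem IsFreeSeparator.of_restrict (hB : IsFreeSeparator M B) (hBE : B ⊆ M.E) (hAB : A ⊆ B)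
    (hA : IsFreeSeparator (M.restrict B) A) : IsFreeSeparator M A := by
  intro C hC
  rcases hB C hC with h | h
  · refine (hA C (hC.isCircuit_restrict_of_subset h)).imp id fun h' => ?_
    rw [M.restrict_closure_eq h hBE] at h'
    exact h'.trans Set.inter_subset_left
  · exact Or.inr (hAB.trans h)

/-- A circuit `C` of the contraction sits in a circuit `C'` of `M` with `C ⊆ C' ⊆ C ∪ A`, to which
the hypothesis on `B` applies. -/
theorem IsFreeSeparator.contract (hB : IsFreeSeparator M B) (A : Set α) :
    IsFreeSeparator (M.contract A) (B \ A) := by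
  intro C hC
  obtain ⟨C', hC', h1, h2⟩ := hC.exists_subset_isCircuit_of_contract
  rw [Matroid.contract_closure_eq]
  rcases hB C' hC' with h | h
  · refine Or.inl (Set.subset_sdiff.2 ⟨h1.trans h, ?_⟩)
    exact (Set.subset_sdiff.1 hC.subset_ground).2
  · exact Or.inr (Set.sdiff_subset_sdiff_left (h.trans (M.closure_subset_closure h2)))

/-- A free separator is characterized by the independent sets. -/
theorem isFreeSeparator_iff [M.Finite] (hA : A ⊆ M.E) : IsFreeSeparator M A ↔
    ∀ X ⊆ M.E, M.Indep (X ∩ A) → (X.ncard : ℤ) ≤ rk M (X ∪ A) → M.Indep X := by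
  constructor
  · intro h X hX hXA hr
    by_contra hd
    obtain ⟨C, hCX, hC⟩ := ((Matroid.not_indep_iff hX).1 hd).exists_isCircuit_subset
    -- A circuit inside `A` contradicts independence of `X ∩ A`. One that spans `A` makes `X` span
    -- `X ∪ A`, so the rank bound makes `X` independent.
    rcases h C hC with h' | h'
    · exact hC.not_indep (hXA.subset (Set.subset_inter hCX h'))
    · have hcl : X ∪ A ⊆ M.closure X :=
        Set.union_subset (M.subset_closure X hX) (h'.trans (M.closure_subset_closure hCX))
      have h1 := rk_mono M hcl
      have h2 : rk M (M.closure X) = rk M X := by rw [rk, M.eRk_closure_eq, rk]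
      have h3 := rk_le_ncard M (M.ground_finite.subset hX)
      exact hd ((indep_iff_rk hX).2 (by omega))
  · intro h C hC
    by_contra! hcon
    obtain ⟨hCA, hAC⟩ := hcon
    -- The circuit itself serves as `X`: a point of `A` outside its closure raises the rank from
    -- `|C| - 1` to `|C|`.
    obtain ⟨e, he, heC⟩ := Set.not_subset.1 hAC
    refine hC.not_indep (h C hC.subset_ground (hC.ssubset_indep ?_) ?_)
    · exact Set.inter_ssubset_left_iff.2 hCA
    · obtain ⟨c, hc⟩ := hC.nonempty
      have hb := hC.sdiff_singleton_isBasis hc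
      have hf := M.ground_finite.subset hC.subset_ground
      have h1 : rk M C = (C.ncard : ℤ) - 1 := by
        have := Set.ncard_sdiff_singleton_add_one hc hf
        unfold rk
        rw [← hb.encard_eq_eRk]
        change ((C \ {c}).ncard : ℤ) = _
        omega
      have h2 : rk M (insert e C) = rk M C + 1 := by
        have h3 := Matroid.eRk_insert_eq_add_one (M := M) (e := e) (X := C) ⟨hA he, heC⟩
        have h4 : M.eRk C ≠ ⊤ :=
          ne_top_of_le_ne_top (M.eRank_ne_top_iff.2 inferInstance) (M.eRk_le_eRank C)
        unfold rk
        rw [h3, ENat.toNat_add h4 (by simp)]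
        simp
      have h5 := rk_mono M (A := insert e C) (B := C ∪ A)
        (Set.insert_subset (Or.inr he) Set.subset_union_left)
      omega

open Classical in
/-- The bijection from `E` to the disjoint union of `A` and `E \ A`. -/
noncomputable def splitMap (A : Set α) (x : α) : α ⊕ α := if x ∈ A then Sum.inl x else Sum.inr x

theorem preimage_inl_splitMap (A X : Set α) : Sum.inl ⁻¹' (splitMap A '' X) = X ∩ A := by
  ext x
  simp only [splitMap, Set.mem_preimage, Set.mem_image, Set.mem_inter_iff]
  constructor
  · rintro ⟨y, hy, h⟩
    split_ifs at h with h'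
    cases h
    exact ⟨hy, h'⟩
  · rintro ⟨hx, h⟩
    exact ⟨x, hx, if_pos h⟩

theorem preimage_inr_splitMap (A X : Set α) : Sum.inr ⁻¹' (splitMap A '' X) = X \ A := by
  ext x
  simp only [splitMap, Set.mem_preimage, Set.mem_image, Set.mem_sdiff]
  constructor
  · rintro ⟨y, hy, h⟩
    split_ifs at h with h'
    cases h
    exact ⟨hy, h'⟩
  · rintro ⟨hx, h⟩
    exact ⟨x, hx, if_neg h⟩

theorem splitMap_injective (A : Set α) : Function.Injective (splitMap A) := by
  intro x y h
  simp only [splitMap] at h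
  split_ifs at h <;> simpa using h

instance [M.Finite] (A : Set α) : (M.contract A).Finite :=
  ⟨M.ground_finite.subset Set.sdiff_subset⟩

theorem bijOn_splitMap [M.Finite] [(M.restrict A).Finite] (hA : A ⊆ M.E) :
    Set.BijOn (splitMap A) M.E (freeProduct (M.restrict A) (M.contract A)).E := by
  have : splitMap A '' M.E = (freeProduct (M.restrict A) (M.contract A)).E := by
    rw [freeProduct_ground, ← Set.image_preimage_inl_union_image_preimage_inr (splitMap A '' M.E),
      preimage_inl_splitMap, preimage_inr_splitMap, Set.inter_eq_right.2 hA]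
    rfl
  rw [← this]
  exact (splitMap_injective A).injOn.bijOn_image

/-- The rank-lack is `ρ(A) - |X ∩ A|` and the nullity is `|X \ A| - ρ(X ∪ A) + ρ(A)`; the terms
`ρ(A)` cancel in their comparison. -/
theorem freeProduct_indep_splitMap [M.Finite] [(M.restrict A).Finite] (hA : A ⊆ M.E)
    (hX : X ⊆ M.E) :
    (freeProduct (M.restrict A) (M.contract A)).Indep (splitMap A '' X) ↔
      M.Indep (X ∩ A) ∧ (X.ncard : ℤ) ≤ rk M (X ∪ A) := by
  rw [freeProduct_indep_iff, FreeProductIndep, preimage_inl_splitMap, preimage_inr_splitMap,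
    Matroid.restrict_indep_iff, and_iff_left Set.inter_subset_right]
  refine and_congr_right fun h => ?_
  rw [and_iff_right (show X \ A ⊆ (M.contract A).E from Set.sdiff_subset_sdiff_left hX)]
  unfold nullity rankLack
  rw [rk_contract hA (Set.sdiff_subset_sdiff_left hX), Matroid.restrict_ground_eq,
    rk_restrict subset_rfl, rk_restrict Set.inter_subset_right, rk_of_indep h,
    Set.sdiff_union_self]
  have := Set.ncard_inter_add_ncard_sdiff_eq_ncard X A (M.ground_finite.subset hX)
  omega

/-- Valid for every `A`, separator or not: splitting a matroid and taking the free product of the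
two parts can only create independent sets. -/
theorem freeProduct_indep_splitMap_of_indep [M.Finite] [(M.restrict A).Finite] (hA : A ⊆ M.E)
    (hX : M.Indep X) : (freeProduct (M.restrict A) (M.contract A)).Indep (splitMap A '' X) := by
  rw [freeProduct_indep_splitMap hA hX.subset_ground, ← rk_of_indep hX]
  exact ⟨hX.subset Set.inter_subset_left, rk_mono M Set.subset_union_left⟩

theorem IsFreeSeparator.isIsoMap [M.Finite] [(M.restrict A).Finite] (h : IsFreeSeparator M A)
    (hA : A ⊆ M.E) : IsIsoMap (splitMap A) M (freeProduct (M.restrict A) (M.contract A)) := by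
  refine ⟨bijOn_splitMap hA, fun X hX => ⟨freeProduct_indep_splitMap_of_indep hA, fun h' => ?_⟩⟩
  rw [freeProduct_indep_splitMap hA hX] at h'
  exact (isFreeSeparator_iff hA).1 h X hX h'.1 h'.2

/-! ### Recovering the two factors from a free product. -/

section FreeProduct

variable (M : Matroid α) (N : Matroid β) [M.Finite] [N.Finite]

instance : (freeProduct M N).Finite :=
  ⟨(M.ground_finite.image _).union (N.ground_finite.image _)⟩

theorem freeProduct_indep_inl (X : Set α) :
    (freeProduct M N).Indep (Sum.inl '' X) ↔ M.Indep X := by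
  rw [freeProduct_indep_iff, FreeProductIndep, Set.preimage_image_eq _ Sum.inl_injective]
  refine and_iff_left_of_imp fun h => ?_
  have h1 := rk_mono M h.subset_ground
  have h2 : rk N ∅ = 0 := by simp [rk]
  simp only [Set.preimage_inr_image_inl]
  refine ⟨Set.empty_subset _, ?_⟩
  unfold nullity rankLack
  simp [h2, h1]

theorem isIsoMap_inl :
    IsIsoMap Sum.inl M ((freeProduct M N).restrict (Sum.inl '' M.E)) := by
  refine ⟨Sum.inl_injective.injOn.bijOn_image, fun X hX => ?_⟩
  rw [Matroid.restrict_indep_iff, freeProduct_indep_inl, and_iff_left (Set.image_mono hX)]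

/-- Over a basis of `M` the rank-lack is zero, so a subset of `N.E` may be added exactly when its
nullity is zero. -/
theorem isIsoMap_inr :
    IsIsoMap Sum.inr N ((freeProduct M N).contract (Sum.inl '' M.E)) := by
  have hE : (freeProduct M N).E \ Sum.inl '' M.E = Sum.inr '' N.E := by
    rw [freeProduct_ground, Set.union_sdiff_left]
    refine sdiff_eq_left.2 (Set.disjoint_left.2 ?_)
    rintro _ ⟨x, _, rfl⟩ ⟨y, _, hy⟩
    cases hy
  obtain ⟨I, hI⟩ := M.exists_isBasis M.E
  have hb : (freeProduct M N).IsBasis (Sum.inl '' I) (Sum.inl '' M.E) := by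
    have h := hI.map (f := Sum.inl (β := β)) Sum.inl_injective.injOn
    rw [← (isIsoMap_inl M N).eq_map] at h
    exact ((Matroid.isBasis_restrict_iff (M := freeProduct M N) Set.subset_union_left).1 h).1
  have hr : rk M I = rk M M.E := by rw [rk, hI.eRk_eq_eRk, rk]
  refine ⟨?_, fun X hX => ?_⟩
  · rw [Matroid.contract_ground, hE]
    exact Sum.inr_injective.injOn.bijOn_image
  · have hd : Disjoint (Sum.inl '' M.E : Set (α ⊕ β)) (Sum.inr '' X) := by
      refine Set.disjoint_left.2 ?_
      rintro _ ⟨x, _, rfl⟩ ⟨y, _, hy⟩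
      cases hy
    rw [hb.contract_indep_iff_of_disjoint hd, freeProduct_indep_iff, FreeProductIndep,
      Set.preimage_union, Set.preimage_union, Set.preimage_inl_image_inr,
      Set.preimage_inr_image_inl, Set.preimage_image_eq _ Sum.inl_injective,
      Set.preimage_image_eq _ Sum.inr_injective, Set.empty_union, Set.union_empty,
      and_iff_right hI.indep, and_iff_right hX, indep_iff_rk hX]
    have h := rk_le_ncard N (N.ground_finite.subset hX)
    unfold nullity rankLack
    rw [hr]
    omega

/-- Since the contraction by the left ground set is `N`, the rank of `X` together with that set is
`ρ_M + ρ_N(X ∩ T)`. The bound of `isFreeSeparator_iff` then becomes the inequality that defines the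
free product. -/
theorem isFreeSeparator_inl : IsFreeSeparator (freeProduct M N) (Sum.inl '' M.E) := by
  have hA : Sum.inl '' M.E ⊆ (freeProduct M N).E := Set.subset_union_left
  rw [isFreeSeparator_iff hA]
  intro X hX hXA hr
  have hXf := (freeProduct M N).ground_finite.subset hX
  have h1 : X ∩ Sum.inl '' M.E = Sum.inl '' (Sum.inl ⁻¹' X) := by
    ext (x | x)
    · simp only [Set.mem_inter_iff, Sum.inl_injective.mem_set_image, Set.mem_preimage]
      refine and_iff_left_of_imp fun h => ?_
      rcases hX h with ⟨y, hy, e⟩ | ⟨y, hy, e⟩ <;> cases e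
      exact hy
    · simp
  rw [h1, freeProduct_indep_inl] at hXA
  have hXN : Sum.inr ⁻¹' X ⊆ N.E := by
    intro x h
    rcases hX h with ⟨y, hy, e⟩ | ⟨y, hy, e⟩ <;> cases e
    exact hy
  have h2 : X ∪ Sum.inl '' M.E = Sum.inr '' (Sum.inr ⁻¹' X) ∪ Sum.inl '' M.E := by
    ext (x | x)
    · simp only [Set.mem_union, Sum.inl_injective.mem_set_image]
      refine ⟨fun h => Or.inr (h.elim (fun h => ?_) id), fun h => Or.inr ?_⟩
      · rcases hX h with ⟨y, hy, e⟩ | ⟨y, hy, e⟩ <;> cases e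
        exact hy
      · simpa using h
    · simp
  have h3 := rk_contract (M := freeProduct M N) hA (X := Sum.inr '' (Sum.inr ⁻¹' X)) (by
    have := (isIsoMap_inr M N).1.image_eq
    rw [Matroid.contract_ground] at this
    rw [← this]
    exact Set.image_mono hXN)
  rw [(isIsoMap_inr M N).rk_image hXN] at h3
  have h4 := (isIsoMap_inl M N).rk_image subset_rfl
  rw [rk_restrict subset_rfl] at h4
  have h5 := ncard_sum hXf
  rw [freeProduct_indep_iff]
  refine ⟨hXA, hXN, ?_⟩
  unfold nullity rankLack
  rw [rk_of_indep hXA]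
  rw [h2] at hr
  omega

end FreeProduct

end Separator

theorem IsIsoMap.isFreeSeparator_image {α β : Type*} {f : α → β} {M : Matroid α} {N : Matroid β}
    [M.Finite] [N.Finite] (h : IsIsoMap f M N) {A : Set α} (hA : A ⊆ M.E)
    (hs : IsFreeSeparator M A) : IsFreeSeparator N (f '' A) := by
  rw [isFreeSeparator_iff ((Set.image_mono hA).trans h.1.image_eq.subset)]
  rw [isFreeSeparator_iff hA] at hs
  intro Y hY hYA hr
  rw [← h.1.image_eq] at hY
  obtain ⟨X, hX, rfl⟩ := Set.subset_image_iff.1 hY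
  rw [← h.1.injOn.image_inter hX hA, ← h.2 _ (Set.inter_subset_left.trans hX)] at hYA
  rw [← Set.image_union, h.rk_image (Set.union_subset hX hA), (h.1.injOn.mono hX).ncard_image] at hr
  exact (h.2 X hX).1 (hs X hX hYA hr)

/-! ### Separators and factorizations of isomorphism classes. -/

namespace FinMatroid

theorem restr_toMatroid {M : FinMatroid} {A : Set ℕ} (hA : A ⊆ M.toMatroid.E) :
    (M.restr A).toMatroid = M.toMatroid.restrict A := by
  simp only [restr, Set.inter_eq_left.2 hA]

theorem contr_toMatroid (M : FinMatroid) (A : Set ℕ) :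
    (M.contr A).toMatroid = M.toMatroid.contract A := rfl

theorem restr_ground {M : FinMatroid} {A : Set ℕ} (hA : A ⊆ M.toMatroid.E) :
    (M.restr A).toMatroid.E = A := by
  rw [restr_toMatroid hA, Matroid.restrict_ground_eq]

theorem contr_ground (M : FinMatroid) (A : Set ℕ) :
    (M.contr A).toMatroid.E = M.toMatroid.E \ A := rfl

theorem restr_restr {M : FinMatroid} {A B : Set ℕ} (hAB : A ⊆ B) (hB : B ⊆ M.toMatroid.E) :
    (M.restr B).restr A = M.restr A := by
  apply ext'
  rw [restr_toMatroid (by rwa [restr_ground hB]), restr_toMatroid hB,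
    restr_toMatroid (hAB.trans hB), Matroid.restrict_restrict_eq _ hAB]

theorem contr_contr {M : FinMatroid} {A B : Set ℕ} (hAB : A ⊆ B) :
    (M.contr A).contr (B \ A) = M.contr B := by
  apply ext'
  rw [contr_toMatroid, contr_toMatroid, contr_toMatroid, Matroid.contract_contract,
    Set.union_sdiff_cancel hAB]

theorem restr_contr {M : FinMatroid} {A B : Set ℕ} (hAB : A ⊆ B) (hB : B ⊆ M.toMatroid.E) :
    (M.restr B).contr A = (M.contr A).restr (B \ A) := by
  apply ext'
  rw [restr_toMatroid (Set.sdiff_subset_sdiff_left hB), contr_toMatroid, contr_toMatroid,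
    restr_toMatroid hB, Matroid.restrict_contract_eq_contract_restrict _ hAB]

theorem restr_self (M : FinMatroid) : M.restr M.toMatroid.E = M :=
  ext' (by rw [restr_toMatroid subset_rfl, Matroid.restrict_ground_eq_self])

theorem contr_empty (M : FinMatroid) : M.contr ∅ = M :=
  ext' (by rw [contr_toMatroid, Matroid.contract_empty])

theorem cls_eq_one_iff {M : FinMatroid} : M.cls = MatroidClass.one ↔ M.toMatroid.E = ∅ :=
  cls_eq_empty_iff

theorem isIsoMap_restr {M : FinMatroid} {A : Set ℕ} (hA : A ⊆ M.toMatroid.E) :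
    IsIsoMap id (M.toMatroid.restrict A) (M.restr A).toMatroid := by
  rw [restr_toMatroid hA]
  exact IsIsoMap.refl _

theorem restrict_finite {M : FinMatroid} {A : Set ℕ} (hA : A ⊆ M.toMatroid.E) :
    (M.toMatroid.restrict A).Finite := by
  rw [← restr_toMatroid hA]
  exact (M.restr A).finite

theorem cls_eq_mul {M : FinMatroid} {A : Set ℕ} (hA : A ⊆ M.toMatroid.E)
    (h : IsFreeSeparator M.toMatroid A) : M.cls = (M.restr A).cls.mul (M.contr A).cls := by
  have := restrict_finite hA
  exact cls_eq_iff.2 ⟨_, (h.isIsoMap hA).trans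
    (((isIsoMap_restr hA).freeProduct (IsIsoMap.refl (M.contr A).toMatroid)).trans
      (isIsoMap_freeProd _ _))⟩

/-- The converse of `cls_eq_mul`: the ground set of the left factor, carried along the isomorphism,
is the separator. -/
theorem exists_freeSeparator {M : FinMatroid} {x y : MatroidClass} (h : M.cls = x.mul y) :
    ∃ A ⊆ M.toMatroid.E, IsFreeSeparator M.toMatroid A ∧ (M.restr A).cls = x ∧
      (M.contr A).cls = y := by
  induction x using Quotient.inductionOn with | _ P
  induction y using Quotient.inductionOn with | _ R
  obtain ⟨f, hf⟩ := cls_eq_iff.1 h.symm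
  have hg := (isIsoMap_freeProd P R).trans hf
  have hA : Sum.inl '' P.toMatroid.E ⊆ (freeProduct P.toMatroid R.toMatroid).E :=
    Set.subset_union_left
  have hA' := (Set.image_mono hA).trans hg.1.image_eq.subset
  refine ⟨_, hA', hg.isFreeSeparator_image hA (isFreeSeparator_inl _ _), ?_, ?_⟩
  · refine Eq.symm (cls_eq_iff.2 ⟨_, ((isIsoMap_inl _ R.toMatroid).trans (hg.restrict hA)).trans
      (isIsoMap_restr hA')⟩)
  · exact Eq.symm (cls_eq_iff.2 ⟨_, (isIsoMap_inr P.toMatroid _).trans (hg.contract hA)⟩)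

end FinMatroid

/-! ### The monoid of isomorphism classes and existence of irreducible factorizations. -/

namespace MatroidClass

open FinMatroid

theorem exists_rep (x : MatroidClass) : ∃ M : FinMatroid, M.cls = x :=
  ⟨Quotient.out x, Quotient.out_eq x⟩

/-- The size of the ground set. -/
noncomputable def size (x : MatroidClass) : ℕ :=
  Quotient.liftOn x (fun M => M.toMatroid.E.ncard) (by
    rintro M N ⟨f, hf⟩
    rw [← hf.1.image_eq, hf.1.injOn.ncard_image])

theorem size_cls (M : FinMatroid) : M.cls.size = M.toMatroid.E.ncard := rfl

theorem size_eq_zero {x : MatroidClass} : x.size = 0 ↔ x = one := by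
  obtain ⟨M, rfl⟩ := x.exists_rep
  rw [size_cls, Set.ncard_eq_zero M.toMatroid.ground_finite, cls_eq_one_iff]

theorem size_mul (x y : MatroidClass) : (x.mul y).size = x.size + y.size := by
  obtain ⟨M, hM⟩ := (x.mul y).exists_rep
  obtain ⟨A, hA, -, rfl, rfl⟩ := exists_freeSeparator hM
  rw [← hM, size_cls, size_cls, size_cls, restr_ground hA, contr_ground, add_comm,
    Set.ncard_sdiff_add_ncard_of_subset hA M.toMatroid.ground_finite]

theorem one_mul (x : MatroidClass) : one.mul x = x := by
  obtain ⟨M, rfl⟩ := x.exists_rep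
  conv_rhs => rw [cls_eq_mul (Set.empty_subset _) (isFreeSeparator_empty M.toMatroid)]
  rw [contr_empty, cls_eq_one_iff.2 (restr_ground (Set.empty_subset _))]

theorem mul_one (x : MatroidClass) : x.mul one = x := by
  obtain ⟨M, rfl⟩ := x.exists_rep
  have h : (M.contr M.toMatroid.E).cls = one :=
    cls_eq_one_iff.2 (by rw [contr_ground, Set.sdiff_self])
  conv_rhs => rw [cls_eq_mul subset_rfl (isFreeSeparator_ground M.toMatroid)]
  rw [restr_self, h]

/-- Both sides describe a chain `A ⊆ B`: the set `A`, a separator of `M|B`, is one of `M`, and `B \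
A` is one of `M/A`. -/
theorem mul_assoc (x y z : MatroidClass) : (x.mul y).mul z = x.mul (y.mul z) := by
  obtain ⟨M, hM⟩ := ((x.mul y).mul z).exists_rep
  obtain ⟨B, hB, sB, h1, h2⟩ := exists_freeSeparator hM
  obtain ⟨A, hA, sA, h3, h4⟩ := exists_freeSeparator h1
  rw [restr_ground hB] at hA
  rw [restr_toMatroid hB] at sA
  rw [restr_restr hA hB] at h3
  rw [restr_contr hA hB] at h4
  rw [← hM, cls_eq_mul (hA.trans hB) (sB.of_restrict hB hA sA), h3,
    cls_eq_mul (M := M.contr A) (A := B \ A) (Set.sdiff_subset_sdiff_left hB) (sB.contract A), h4,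
    contr_contr hA, h2]

theorem prod_nil : prod [] = one := rfl

theorem prod_cons (x : MatroidClass) (l : List MatroidClass) : prod (x :: l) = x.mul (prod l) := rfl

theorem prod_append (l l' : List MatroidClass) : prod (l ++ l') = (prod l).mul (prod l') := by
  induction l with
  | nil => rw [prod_nil, one_mul, List.nil_append]
  | cons x l ih => rw [List.cons_append, prod_cons, prod_cons, ih, mul_assoc]

theorem IsIrred.eq_one_or_eq_one {x a b : MatroidClass} (hx : x.IsIrred) (h : x = a.mul b) :
    a = one ∨ b = one := by
  have hmem := hx.2 [a, b] (by rw [prod_cons, prod_cons, prod_nil, mul_one, h])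
  have hs := congrArg size h
  rw [size_mul] at hs
  simp only [List.mem_cons, List.not_mem_nil, or_false] at hmem
  rcases hmem with rfl | rfl
  · exact Or.inr (size_eq_zero.1 (by omega))
  · exact Or.inl (size_eq_zero.1 (by omega))

theorem eq_of_prod_of_size_le {x y : MatroidClass} {l : List MatroidClass} (h : prod l = x)
    (hy : y ∈ l) : y.size < x.size ∨ y = x := by
  obtain ⟨s, t, rfl⟩ := List.append_of_mem hy
  rw [prod_append, prod_cons] at h
  have hs := congrArg size h
  rw [size_mul, size_mul] at hs
  by_cases h0 : y.size < x.size
  · exact Or.inl h0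
  · right
    rw [← h, size_eq_zero.1 (show (prod s).size = 0 by omega),
      size_eq_zero.1 (show (prod t).size = 0 by omega), one_mul, mul_one]

/-- Induction on size: a nonempty class that is not irreducible has a factorization avoiding itself,
and a factor different from the product is strictly smaller. -/
theorem exists_irredFactorization (x : MatroidClass) : ∃ l, IsIrredFactorization l x := by
  induction h : x.size using Nat.strong_induction_on generalizing x with
  | _ n ih =>
    by_cases h1 : x = one
    · exact ⟨[], by simp, h1.symm⟩
    by_cases h2 : x.IsIrred
    · exact ⟨[x], by simpa using h2, mul_one x⟩
    have h3 : ∃ l, prod l = x ∧ x ∉ l := by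
      by_contra! hcon
      exact h2 ⟨h1, hcon⟩
    obtain ⟨l, hl, hxl⟩ := h3
    have h4 : ∀ y ∈ l, ∃ l', IsIrredFactorization l' y := by
      intro y hy
      rcases eq_of_prod_of_size_le hl hy with hlt | rfl
      · exact ih _ (h ▸ hlt) y rfl
      · exact absurd hy hxl
    rw [← hl]
    clear hl hxl
    induction l with
    | nil => exact ⟨[], by simp, rfl⟩
    | cons y l ih' =>
      obtain ⟨s, hs1, hs2⟩ := h4 y List.mem_cons_self
      obtain ⟨t, ht1, ht2⟩ := ih' fun z hz => h4 z (List.mem_cons_of_mem _ hz)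
      refine ⟨s ++ t, fun z hz => ?_, ?_⟩
      · exact (List.mem_append.1 hz).elim (hs1 z) (ht1 z)
      · rw [prod_append, hs2, ht2, prod_cons]

end MatroidClass

/-! ### Uniqueness of irreducible factorizations. -/

namespace FinMatroid

open MatroidClass

theorem eq_empty_or_eq_of_isIrred {M : FinMatroid} (hM : M.cls.IsIrred) {A : Set ℕ}
    (hA : A ⊆ M.toMatroid.E) (h : IsFreeSeparator M.toMatroid A) :
    A = ∅ ∨ A = M.toMatroid.E := by
  rcases hM.eq_one_or_eq_one (cls_eq_mul hA h) with h1 | h1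
  · rw [cls_eq_one_iff, restr_ground hA] at h1
    exact Or.inl h1
  · rw [cls_eq_one_iff, contr_ground, Set.sdiff_eq_empty] at h1
    exact Or.inr (hA.antisymm h1)

/-- Every separator contained in an irreducible separator is trivial. -/
theorem IsFreeSeparator.eq_empty_or_eq {M : FinMatroid} {A B : Set ℕ} (hB : B ⊆ M.toMatroid.E)
    (hBi : (M.restr B).cls.IsIrred) (hA : IsFreeSeparator M.toMatroid A) (hAB : A ⊆ B) :
    A = ∅ ∨ A = B := by
  have h := eq_empty_or_eq_of_isIrred hBi (A := A) (by rwa [restr_ground hB])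
    (by rw [restr_toMatroid hB]; exact hA.restrict hAB hB)
  rwa [restr_ground hB] at h

/-- If `A` and `B` are incomparable separators and `A` is irreducible, then `A` is a singleton. -/
theorem exists_eq_singleton {M : FinMatroid} {A B : Set ℕ} (hA : A ⊆ M.toMatroid.E)
    (sA : IsFreeSeparator M.toMatroid A) (sB : IsFreeSeparator M.toMatroid B)
    (hAi : (M.restr A).cls.IsIrred) (hAB : ¬ A ⊆ B) (hBA : ¬ B ⊆ A) : ∃ a, A = {a} := by
  have hd : A ∩ B = ∅ :=
    (IsFreeSeparator.eq_empty_or_eq hA hAi (sA.inter sB) Set.inter_subset_left).resolve_right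
      fun h => hAB (Set.inter_eq_left.1 h)
  obtain ⟨a, ha, -⟩ := Set.not_subset.1 hAB
  refine ⟨a, ?_⟩
  -- A circuit `C ⊆ A` misses `B`, hence spans it. A point `b` of `B \ A` then lies on a circuit
  -- inside `C ∪ {b}`, which is not contained in `A` and so spans `A`; thus `C` spans `a`.
  have hs : IsFreeSeparator M.toMatroid {a} := by
    refine sA.of_restrict hA (Set.singleton_subset_iff.2 ha) fun C hC => Or.inr ?_
    rw [Matroid.restrict_isCircuit_iff hA] at hC
    rw [M.toMatroid.restrict_closure_eq hC.2 hA, Set.singleton_subset_iff]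
    refine ⟨?_, ha⟩
    have hBC : B ⊆ M.toMatroid.closure C := by
      refine (sB C hC.1).resolve_left fun h => ?_
      obtain ⟨c, hc⟩ := hC.1.nonempty
      exact (Set.eq_empty_iff_forall_notMem.1 hd c) ⟨hC.2 hc, h hc⟩
    obtain ⟨b, hb, hbA⟩ := Set.not_subset.1 hBA
    obtain ⟨C', hC', hC'c, hbC'⟩ := Matroid.exists_isCircuit_of_mem_closure (hBC hb)
      fun h => hbA (hC.2 h)
    have h1 := (sA C' hC'c).resolve_left fun h => hbA (h hbC')
    have h2 : M.toMatroid.closure C' ⊆ M.toMatroid.closure C :=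
      M.toMatroid.closure_subset_closure_of_subset_closure
        (hC'.trans (Set.insert_subset (hBC hb) (M.toMatroid.subset_closure C hC.1.subset_ground)))
    exact h2 (h1 ha)
  rcases IsFreeSeparator.eq_empty_or_eq hA hAi hs (Set.singleton_subset_iff.2 ha) with h | h
  · exact absurd h (Set.singleton_ne_empty a)
  · exact h.symm

theorem cls_eq_of_singleton {M N : FinMatroid} {a b : ℕ} (hM : M.toMatroid.E = {a})
    (hN : N.toMatroid.E = {b}) (h : rk M.toMatroid {a} = rk N.toMatroid {b}) : M.cls = N.cls := by
  refine cls_eq_iff.2 ⟨fun _ => b, ?_, fun I hI => ?_⟩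
  · rw [hM, hN]
    exact Set.bijOn_singleton.2 rfl
  · rw [hM, Set.subset_singleton_iff_eq] at hI
    rcases hI with rfl | rfl
    · simp
    · rw [Set.image_singleton, indep_iff_rk hM.ge, indep_iff_rk hN.ge, h, Set.ncard_singleton,
        Set.ncard_singleton]

end FinMatroid

namespace MatroidClass

open FinMatroid

/-- Nested irreducible separators coincide. Incomparable ones are single points `a`, `b` of equal
rank; then `M/a` and `M/b` each split into a one-point matroid and `M/{a, b}`, with equal ranks on
the one-point parts. -/
theorem mul_cancel_of_isIrred {p q p' q' : MatroidClass} (hp : p.IsIrred) (hp' : p'.IsIrred)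
    (h : p.mul q = p'.mul q') : p = p' ∧ q = q' := by
  obtain ⟨M, hM⟩ := (p.mul q).exists_rep
  obtain ⟨A, hA, sA, rfl, rfl⟩ := exists_freeSeparator hM
  obtain ⟨B, hB, sB, rfl, rfl⟩ := exists_freeSeparator (hM.trans h)
  have hne : ∀ {X}, X ⊆ M.toMatroid.E → (M.restr X).cls.IsIrred → X ≠ ∅ := by
    rintro X hX hXi rfl
    exact hXi.1 (cls_eq_one_iff.2 (restr_ground hX))
  by_cases hAB : A ⊆ B
  · obtain rfl := (IsFreeSeparator.eq_empty_or_eq hB hp' sA hAB).resolve_left (hne hA hp)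
    exact ⟨rfl, rfl⟩
  by_cases hBA : B ⊆ A
  · obtain rfl := (IsFreeSeparator.eq_empty_or_eq hA hp sB hBA).resolve_left (hne hB hp')
    exact ⟨rfl, rfl⟩
  obtain ⟨a, rfl⟩ := exists_eq_singleton hA sA sB hp hAB hBA
  obtain ⟨b, rfl⟩ := exists_eq_singleton hB sB sA hp' hBA hAB
  have hab : a ≠ b := by
    rintro rfl
    exact hAB subset_rfl
  have hr : rk M.toMatroid {a} = rk M.toMatroid {b} := by
    -- If `c` is a loop, the circuit `{c}` is not inside `{d}`, so it spans `d`, and `d` is a loop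
    -- too.
    have key : ∀ {c d : ℕ}, c ≠ d → {d} ⊆ M.toMatroid.E →
        IsFreeSeparator M.toMatroid {d} → {c} ⊆ M.toMatroid.E →
        ¬ M.toMatroid.Indep {c} → ¬ M.toMatroid.Indep {d} := by
      intro c d hcd hd sd hc hi
      rw [Matroid.not_indep_iff hc] at hi
      obtain ⟨C, hCc, hC⟩ := hi.exists_isCircuit_subset
      rw [Set.Nonempty.subset_singleton_iff hC.nonempty] at hCc
      subst hCc
      have h1 := (sd _ hC).resolve_left (by simpa using hcd)
      have h2 : rk M.toMatroid {d} ≤ rk M.toMatroid {c} := by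
        have := rk_mono M.toMatroid h1
        rwa [rk, rk, M.toMatroid.eRk_closure_eq] at this
      have h3 := rk_le_ncard M.toMatroid (Set.finite_singleton c)
      have h4 := mt (indep_iff_rk hc).2 hC.not_indep
      rw [indep_iff_rk hd]
      rw [Set.ncard_singleton] at *
      omega
    have h1 := key hab hB sB hA
    have h2 := key hab.symm hA sA hB
    rw [indep_iff_rk hA, indep_iff_rk hB, Set.ncard_singleton, Set.ncard_singleton] at h1 h2
    have h3 := rk_le_ncard M.toMatroid (Set.finite_singleton a)
    have h4 := rk_le_ncard M.toMatroid (Set.finite_singleton b)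
    have h5 := rk_nonneg M.toMatroid {a}
    have h6 := rk_nonneg M.toMatroid {b}
    rw [Set.ncard_singleton] at h3 h4
    omega
  have key : ∀ {c d : ℕ}, c ≠ d → {c} ⊆ M.toMatroid.E → {d} ⊆ M.toMatroid.E →
      IsFreeSeparator M.toMatroid {d} → (M.contr {c}).cls =
        ((M.contr {c}).restr {d}).cls.mul (M.contr {c, d}).cls := by
    intro c d hcd hc hd sd
    have hdc : ({d} : Set ℕ) \ {c} = {d} := by simpa using hcd.symm
    have hs := sd.contract {c}
    rw [hdc] at hs
    have hdE : {d} ⊆ (M.contr {c}).toMatroid.E := by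
      rw [contr_ground]
      conv_lhs => rw [← hdc]
      exact Set.sdiff_subset_sdiff_left hd
    rw [cls_eq_mul hdE hs]
    congr 2
    have h1 : ({c, d} : Set ℕ) \ {c} = {d} := by
      rw [Set.insert_sdiff_of_mem _ (Set.mem_singleton c), hdc]
    rw [← contr_contr (M := M) (A := {c}) (B := {c, d}) (by simp), h1]
  have hbE : {b} ⊆ M.toMatroid.E \ {a} := by
    simpa [hab.symm] using hB
  have haE : {a} ⊆ M.toMatroid.E \ {b} := by
    simpa [hab] using hA
  constructor
  · refine cls_eq_of_singleton (restr_ground hA) (restr_ground hB) ?_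
    rw [restr_toMatroid hA, restr_toMatroid hB, rk_restrict subset_rfl, rk_restrict subset_rfl, hr]
  · rw [key hab hA hB sB, key hab.symm hB hA sA, Set.pair_comm b a]
    congr 1
    have hbE' : {b} ⊆ (M.contr {a}).toMatroid.E := hbE
    have haE' : {a} ⊆ (M.contr {b}).toMatroid.E := haE
    -- Both ranks are the rank of `{a, b}` minus the common rank of a single point.
    refine cls_eq_of_singleton (restr_ground hbE') (restr_ground haE') ?_
    rw [restr_toMatroid hbE', restr_toMatroid haE', rk_restrict subset_rfl,
      rk_restrict subset_rfl, contr_toMatroid, contr_toMatroid, rk_contract hA hbE,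
      rk_contract hB haE, hr, Set.union_comm]

/-- Factorization into irreducible matroids is unique. -/
theorem eq_of_prod_eq {l l' : List MatroidClass} (hl : ∀ y ∈ l, IsIrred y)
    (hl' : ∀ y ∈ l', IsIrred y) (h : prod l = prod l') : l = l' := by
  have key : ∀ {y : MatroidClass} {s : List MatroidClass}, y.IsIrred → prod (y :: s) ≠ one := by
    intro y s hy he
    have h1 := congrArg size he
    rw [prod_cons, size_mul, size_eq_zero.2 rfl] at h1
    exact hy.1 (size_eq_zero.1 (by omega))
  induction l generalizing l' with
  | nil =>
    obtain _ | ⟨y, l'⟩ := l'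
    · rfl
    · exact absurd h.symm (key (hl' y List.mem_cons_self))
  | cons x l ih =>
    obtain _ | ⟨y, l'⟩ := l'
    · exact absurd h (key (hl x List.mem_cons_self))
    · obtain ⟨rfl, h2⟩ := mul_cancel_of_isIrred (hl x List.mem_cons_self)
        (hl' y List.mem_cons_self) h
      rw [ih (fun z hz => hl z (List.mem_cons_of_mem _ hz))
        (fun z hz => hl' z (List.mem_cons_of_mem _ hz)) h2]

theorem irredFactors_spec (x : MatroidClass) : IsIrredFactorization x.irredFactors x := by
  have h := x.exists_irredFactorization
  rw [irredFactors, dif_pos h]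
  exact h.choose_spec

theorem irredFactors_prod {l : List MatroidClass} (hl : ∀ y ∈ l, IsIrred y) :
    (prod l).irredFactors = l :=
  eq_of_prod_eq (irredFactors_spec _).1 hl (irredFactors_spec _).2

end MatroidClass

/-! ### Bijections that preserve independence. -/

section WeakMap

variable {α β γ : Type*}

/-- `f` restricts to a bijection of the ground sets which preserves independence. -/
def IsWeakMap (f : α → β) (M : Matroid α) (N : Matroid β) : Prop :=
  Set.BijOn f M.E N.E ∧ ∀ I, M.Indep I → N.Indep (f '' I)

theorem IsIsoMap.isWeakMap {f : α → β} {M : Matroid α} {N : Matroid β} (h : IsIsoMap f M N) :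
    IsWeakMap f M N :=
  ⟨h.1, fun I hI => (h.2 I hI.subset_ground).1 hI⟩

theorem IsWeakMap.trans {f : α → β} {g : β → γ} {M : Matroid α} {N : Matroid β} {L : Matroid γ}
    (h : IsWeakMap f M N) (h' : IsWeakMap g N L) : IsWeakMap (g ∘ f) M L :=
  ⟨h'.1.comp h.1, fun I hI => by rw [Set.image_comp]; exact h'.2 _ (h.2 I hI)⟩

theorem IsWeakMap.rk_le {f : α → β} {M : Matroid α} {N : Matroid β} [N.Finite]
    (h : IsWeakMap f M N) {A : Set α} (hA : A ⊆ M.E) : rk M A ≤ rk N (f '' A) := by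
  obtain ⟨I, hI⟩ := M.exists_isBasis A hA
  have h1 : rk M A = I.ncard := by rw [rk, ← hI.encard_eq_eRk]; rfl
  rw [h1, ← (h.1.injOn.mono hI.indep.subset_ground).ncard_image, ← rk_of_indep (h.2 I hI.indep)]
  exact rk_mono N (Set.image_mono hI.subset)

theorem preimage_inl_image_sumMap {α' β' : Type*} (f : α → α') (g : β → β') (I : Set (α ⊕ β)) :
    Sum.inl ⁻¹' (Sum.map f g '' I) = f '' (Sum.inl ⁻¹' I) := by
  ext x
  simp

theorem preimage_inr_image_sumMap {α' β' : Type*} (f : α → α') (g : β → β') (I : Set (α ⊕ β)) :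
    Sum.inr ⁻¹' (Sum.map f g '' I) = g '' (Sum.inr ⁻¹' I) := by
  ext x
  simp

/-- Ranks can only grow along `f` and `g` while cardinalities are kept. The independent part in `M`
keeps its rank, so its rank-lack does not drop, and the nullity of the part in `N` does not rise. -/
theorem IsWeakMap.freeProduct {α' β' : Type*} {f : α → α'} {g : β → β'} {M : Matroid α}
    {M' : Matroid α'} {N : Matroid β} {N' : Matroid β'} [M.Finite] [M'.Finite] [N.Finite]
    [N'.Finite] (h : IsWeakMap f M M') (h' : IsWeakMap g N N') :
    IsWeakMap (Sum.map f g) (freeProduct M N) (freeProduct M' N') := by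
  constructor
  · have hi : Set.InjOn (Sum.map f g) (FreeProd.freeProduct M N).E := by
      rintro _ (⟨a, ha, rfl⟩ | ⟨a, ha, rfl⟩) _ (⟨b, hb, rfl⟩ | ⟨b, hb, rfl⟩) hab
      · rw [h.1.injOn ha hb (Sum.inl_injective hab)]
      · cases hab
      · cases hab
      · rw [h'.1.injOn ha hb (Sum.inr_injective hab)]
    have he : Sum.map f g '' (FreeProd.freeProduct M N).E = (FreeProd.freeProduct M' N').E := by
      rw [freeProduct_ground, freeProduct_ground, Set.image_union, Set.image_image,
        Set.image_image, ← h.1.image_eq, ← h'.1.image_eq, Set.image_image, Set.image_image]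
      rfl
    rw [← he]
    exact hi.bijOn_image
  · rintro I ⟨h1, h2, h3⟩
    rw [freeProduct_indep_iff, FreeProductIndep, preimage_inl_image_sumMap,
      preimage_inr_image_sumMap]
    refine ⟨h.2 _ h1, (Set.image_mono h2).trans h'.1.image_eq.subset, ?_⟩
    have r1 := h.rk_le subset_rfl
    rw [h.1.image_eq] at r1
    have r2 := h'.rk_le h2
    have r3 := (h.1.injOn.mono h1.subset_ground).ncard_image
    have r4 := (h'.1.injOn.mono h2).ncard_image
    unfold nullity rankLack at *
    rw [rk_of_indep (h.2 _ h1), r3, r4]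
    rw [rk_of_indep h1] at h3
    omega

theorem finite_indep (M : Matroid α) [M.Finite] : {I | M.Indep I}.Finite :=
  M.ground_finite.finite_subsets.subset fun _ hI => hI.subset_ground

theorem IsWeakMap.injOn_image {f : α → β} {M : Matroid α} {N : Matroid β} (h : IsWeakMap f M N) :
    Set.InjOn (fun I : Set α => f '' I) {I | M.Indep I} := fun _ hI _ hJ hIJ =>
  (h.1.injOn.image_eq_image_iff (Matroid.Indep.subset_ground hI)
    (Matroid.Indep.subset_ground hJ)).1 hIJ

theorem IsWeakMap.ncard_indep_le {f : α → β} {M : Matroid α} {N : Matroid β} [N.Finite]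
    (h : IsWeakMap f M N) : {I | M.Indep I}.ncard ≤ {I | N.Indep I}.ncard :=
  Set.ncard_le_ncard_of_injOn _ (fun I hI => h.2 I hI) h.injOn_image (finite_indep N)

/-- Taking images injects independent sets into independent sets; under the count hypothesis this
injection is onto, so independence is reflected. -/
theorem IsWeakMap.isIsoMap {f : α → β} {M : Matroid α} {N : Matroid β} [N.Finite]
    (h : IsWeakMap f M N) (hc : {I | N.Indep I}.ncard ≤ {I | M.Indep I}.ncard) :
    IsIsoMap f M N := by
  refine ⟨h.1, fun I hI => ⟨h.2 I, fun hI' => ?_⟩⟩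
  rw [← h.injOn_image.ncard_image] at hc
  have he := Set.eq_of_subset_of_ncard_le (Set.image_subset_iff.2 fun I hI => h.2 I hI) hc
    (finite_indep N)
  obtain ⟨J, hJ, hJI⟩ := he.ge (show f '' I ∈ {I | N.Indep I} from hI')
  change M.Indep J at hJ
  rwa [← (h.1.injOn.image_eq_image_iff hJ.subset_ground hI).1 hJI]

end WeakMap

/-! ### Counting multisections. -/

namespace FinMatroid

theorem interval_contr {M : FinMatroid} {A T T' : Set ℕ} (hA : A ⊆ M.toMatroid.E) (hT : T ⊆ T')
    (hT' : T' ⊆ M.toMatroid.E \ A) :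
    (M.contr A).interval T T' = M.interval (A ∪ T) (A ∪ T') := by
  have hd : ∀ {X}, X ⊆ T' → (A ∪ X) \ A = X := fun {X} hX => by
    rw [Set.union_sdiff_left]
    exact sdiff_eq_left.2 (Set.subset_sdiff.1 (hX.trans hT')).2
  have h1 := restr_contr (M := M) (A := A) (B := A ∪ T') Set.subset_union_left
    (Set.union_subset hA (hT'.trans Set.sdiff_subset))
  rw [hd subset_rfl] at h1
  rw [interval, interval, ← h1, ← contr_contr (M := M.restr (A ∪ T')) (A := A) (B := A ∪ T)
    Set.subset_union_left, hd hT]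

theorem IsMultisection.cons {M : FinMatroid} {A : Set ℕ} (hA : A ⊆ M.toMatroid.E)
    {l : List MatroidClass} {t : Fin (l.length + 1) → Set ℕ} (h : (M.contr A).IsMultisection l t) :
    M.IsMultisection ((M.restr A).cls :: l)
      (Fin.cons ∅ fun i => A ∪ t i : Fin (l.length + 1 + 1) → Set ℕ) := by
  refine ⟨rfl, ?_, ?_, fun i => ?_⟩
  · change A ∪ t (Fin.last _) = _
    rw [h.2.1, contr_ground, Set.union_sdiff_cancel hA]
  · refine Fin.monotone_iff_le_succ.2 fun i => ?_
    induction i using Fin.cases with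
    | zero => exact Set.empty_subset _
    | succ i => exact Set.union_subset_union_right A (h.2.2.1 (Fin.castSucc_le_succ i))
  · change Fin (l.length + 1) at i
    induction i using Fin.cases with
    | zero =>
      change (M.interval ∅ (A ∪ t 0)).cls = _
      rw [h.1, Set.union_empty, interval, contr_empty]
      rfl
    | succ i =>
      change (M.interval (A ∪ t i.castSucc) (A ∪ t i.succ)).cls = l.get i
      rw [← h.2.2.2 i, interval_contr hA (h.2.2.1 (Fin.castSucc_le_succ i)) (h.subset_ground _)]

theorem IsMultisection.tail {M : FinMatroid} {x : MatroidClass} {l : List MatroidClass}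
    {s : Fin (l.length + 1 + 1) → Set ℕ} (h : M.IsMultisection (x :: l) s) :
    (M.restr (s 1)).cls = x ∧ (M.contr (s 1)).IsMultisection l (fun i => s i.succ \ s 1) := by
  have hle : ∀ i : Fin (l.length + 1), s 1 ⊆ s i.succ := fun i => h.2.2.1 (by
    rw [← Fin.succ_zero_eq_one]
    exact Fin.succ_le_succ_iff.2 (Fin.zero_le i))
  refine ⟨?_, ?_, ?_, ?_, fun i => ?_⟩
  · have h1 := h.2.2.2 0
    change (M.interval (s 0) (s 1)).cls = x at h1
    rwa [h.1, interval, contr_empty] at h1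
  · exact Set.sdiff_self
  · change s (Fin.last (l.length + 1)) \ s 1 = _
    rw [contr_ground, ← h.2.1]
    rfl
  · exact fun i j hij => Set.sdiff_subset_sdiff_left (h.2.2.1 (Fin.succ_le_succ_iff.2 hij))
  · have hs := h.2.2.1 (Fin.castSucc_le_succ i.succ)
    change ((M.contr (s 1)).interval (s i.succ.castSucc \ s 1) (s i.succ.succ \ s 1)).cls = _
    have hle' : s 1 ⊆ s i.succ.castSucc := hle i.castSucc
    rw [interval_contr (h.subset_ground 1) (Set.sdiff_subset_sdiff_left hs)
      (Set.sdiff_subset_sdiff_left (h.subset_ground _)), Set.union_sdiff_cancel hle',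
      Set.union_sdiff_cancel (hle i.succ)]
    exact h.2.2.2 i.succ

theorem subset_ground_iff {M : FinMatroid} {A : Finset ℕ} :
    A ⊆ M.ground ↔ (A : Set ℕ) ⊆ M.toMatroid.E := by
  rw [← Finset.coe_subset, coe_ground]

-- The first set `S₁ = A` is chosen freely among those of type `x`. Removing `A` from the later sets
-- gives a multisection of `M/A`, and adjoining it is the inverse operation.
open Classical in
theorem multisection_cons (M : FinMatroid) (x : MatroidClass) (l : List MatroidClass) :
    M.multisection (x :: l) =
      ∑ A ∈ M.ground.powerset, if (M.restr A).cls = x then (M.contr A).multisection l else 0 := by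
  rw [← Finset.sum_filter]
  set S := M.ground.powerset.filter fun A : Finset ℕ => (M.restr A).cls = x with hS
  have hmem : ∀ A : S, (A.1 : Set ℕ) ⊆ M.toMatroid.E ∧ (M.restr A.1).cls = x := fun A => by
    have h := Finset.mem_filter.1 A.2
    rwa [Finset.mem_powerset, subset_ground_iff] at h
  unfold multisection
  rw [← Finset.sum_coe_sort S, ← Nat.card_sigma]
  symm
  refine Nat.card_congr (Equiv.ofBijective
    (fun p : Σ A : S, {t // (M.contr A).IsMultisection l t} =>
      (⟨Fin.cons ∅ fun i => p.1 ∪ p.2.1 i, by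
        have := p.2.2.cons (hmem p.1).1
        rwa [(hmem p.1).2] at this⟩ : {s // M.IsMultisection (x :: l) s})) ⟨?_, ?_⟩)
  · rintro ⟨A, t, ht⟩ ⟨B, t', ht'⟩ hst
    have h : ∀ i, (A.1 : Set ℕ) ∪ t i = (B.1 : Set ℕ) ∪ t' i := fun i =>
      congrFun (congrArg Subtype.val hst) i.succ
    have h0 := h 0
    rw [ht.1, ht'.1, Set.union_empty, Set.union_empty, Finset.coe_inj] at h0
    obtain rfl : A = B := Subtype.ext h0
    congr 2
    ext i : 1
    have h1 := h i
    have e1 := ht.subset_ground i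
    have e2 := ht'.subset_ground i
    rw [contr_ground] at e1 e2
    have h2 := congrArg (· \ (A.1 : Set ℕ)) h1
    simp only [Set.union_sdiff_left] at h2
    rwa [sdiff_eq_left.2 (Set.subset_sdiff.1 e1).2, sdiff_eq_left.2 (Set.subset_sdiff.1 e2).2] at h2
  · rintro ⟨s, hs⟩
    have hf := M.toMatroid.ground_finite.subset (hs.subset_ground 1)
    obtain ⟨h1, h2⟩ := hs.tail
    have hA : hf.toFinset ∈ S := by
      rw [hS, Finset.mem_filter, Finset.mem_powerset, subset_ground_iff, hf.coe_toFinset]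
      exact ⟨hs.subset_ground 1, h1⟩
    refine ⟨⟨⟨hf.toFinset, hA⟩, fun i => s i.succ \ s 1, by rwa [hf.coe_toFinset]⟩, ?_⟩
    refine Subtype.ext (funext fun i => ?_)
    change Fin (l.length + 1 + 1) at i
    induction i using Fin.cases with
    | zero => exact hs.1.symm
    | succ i =>
      change (hf.toFinset : Set ℕ) ∪ s i.succ \ s 1 = s i.succ
      rw [hf.coe_toFinset, Set.union_sdiff_cancel]
      refine hs.2.2.1 ?_
      rw [← Fin.succ_zero_eq_one]
      exact Fin.succ_le_succ_iff.2 (Fin.zero_le i)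

open Classical in
theorem multisection_nil (M : FinMatroid) :
    M.multisection [] = if M.toMatroid.E = ∅ then 1 else 0 := by
  unfold multisection
  split_ifs with h
  · rw [Nat.card_eq_one_iff_unique]
    refine ⟨⟨?_⟩, ⟨⟨fun _ => ∅, rfl, h.symm, fun _ _ _ => subset_rfl, fun i => i.elim0⟩⟩⟩
    rintro ⟨s, hs⟩ ⟨t, ht⟩
    refine Subtype.ext (funext fun i => ?_)
    rw [Subsingleton.elim (α := Fin 1) i 0]
    exact hs.1.trans ht.1.symm
  · have : IsEmpty {s // M.IsMultisection [] s} := ⟨fun s => h (s.2.2.1.symm.trans s.2.1)⟩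
    exact Nat.card_of_isEmpty

open Classical in
theorem multisection_singleton (M : FinMatroid) (x : MatroidClass) :
    M.multisection [x] = if M.cls = x then 1 else 0 := by
  rw [multisection_cons, Finset.sum_eq_single M.ground]
  · rw [coe_ground, restr_self, multisection_nil, contr_ground, Set.sdiff_self, if_pos rfl]
  · intro A hA hne
    rw [multisection_nil, contr_ground, if_neg (c := _ = ∅), ite_self]
    rw [Set.sdiff_eq_empty, ← coe_ground, Finset.coe_subset]
    exact fun h => hne ((Finset.mem_powerset.1 hA).antisymm h)
  · exact fun h => absurd (Finset.mem_powerset_self _) h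

/-- A matroid is below every product of a sequence of matroids for which it has a multisection. -/
theorem exists_isWeakMap {M N : FinMatroid} {l : List MatroidClass} (h : M.multisection l ≠ 0)
    (hN : N.cls = MatroidClass.prod l) : ∃ f : ℕ → ℕ, IsWeakMap f M.toMatroid N.toMatroid := by
  classical
  induction l generalizing M N with
  | nil =>
    rw [multisection_nil] at h
    have hM : M.cls = N.cls := by
      rw [hN]
      exact cls_eq_one_iff.2 (by_contra fun h' => h (if_neg h'))
    obtain ⟨f, hf⟩ := cls_eq_iff.1 hM
    exact ⟨f, hf.isWeakMap⟩
  | cons x l ih =>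
    rw [multisection_cons] at h
    obtain ⟨A, hA, hne⟩ := Finset.exists_ne_zero_of_sum_ne_zero h
    rw [Finset.mem_powerset, subset_ground_iff] at hA
    obtain ⟨hx, hne⟩ := ite_ne_right_iff.1 hne
    obtain ⟨R, hR⟩ := (MatroidClass.prod l).exists_rep
    obtain ⟨g, hg⟩ := ih hne hR
    have hfin := restrict_finite hA
    -- `M` lies below `M|A □ M/A`, and induction replaces `M/A` by a matroid `R` in the class of the
    -- product of `l`.
    have h1 : IsWeakMap (splitMap (A : Set ℕ)) M.toMatroid
        (freeProduct (M.toMatroid.restrict A) (M.toMatroid.contract A)) :=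
      ⟨bijOn_splitMap hA, fun I hI => freeProduct_indep_splitMap_of_indep hA hI⟩
    have h2 := ((isIsoMap_restr hA).isWeakMap).freeProduct hg
    have h3 := (isIsoMap_freeProd (M.restr A) R).isWeakMap
    have h4 : ((M.restr A).freeProd R).cls = N.cls := by
      rw [hN, MatroidClass.prod_cons, ← hx, ← hR]
      rfl
    obtain ⟨f, hf⟩ := cls_eq_iff.1 h4
    exact ⟨_, ((h1.trans h2).trans h3).trans hf.isWeakMap⟩

/-- The separators belonging to the factorization form such a chain. -/
theorem multisection_ne_zero {M : FinMatroid} {l : List MatroidClass}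
    (h : M.cls = MatroidClass.prod l) : M.multisection l ≠ 0 := by
  classical
  induction l generalizing M with
  | nil =>
    rw [multisection_nil, if_pos (cls_eq_one_iff.1 h)]
    exact one_ne_zero
  | cons x l ih =>
    obtain ⟨A, hA, -, h1, h2⟩ := exists_freeSeparator h
    have hf := M.toMatroid.ground_finite.subset hA
    rw [multisection_cons]
    intro h0
    rw [Finset.sum_eq_zero_iff] at h0
    have h3 := h0 hf.toFinset (by
      rwa [Finset.mem_powerset, subset_ground_iff, hf.coe_toFinset])
    rw [hf.coe_toFinset, if_pos h1] at h3
    exact ih h2 h3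

end FinMatroid

/-! ### Triangularity of the coefficients and finiteness in each size. -/

namespace MatroidClass

open FinMatroid

/-- The number of independent sets. -/
noncomputable def numIndep (x : MatroidClass) : ℕ :=
  Quotient.liftOn x (fun M => {I | M.toMatroid.Indep I}.ncard) (by
    rintro M N ⟨f, hf⟩
    obtain ⟨g, hg⟩ := hf.exists_symm
    exact le_antisymm hf.isWeakMap.ncard_indep_le hg.isWeakMap.ncard_indep_le)

theorem numIndep_le (x : MatroidClass) : x.numIndep ≤ 2 ^ x.size := by
  obtain ⟨M, rfl⟩ := x.exists_rep
  rw [size_cls, ← Set.ncard_powerset _ M.toMatroid.ground_finite]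
  exact Set.ncard_le_ncard (fun _ hI => Matroid.Indep.subset_ground hI)
    M.toMatroid.ground_finite.finite_subsets

/-- A multisection yields a weak map from `x` to `y`, the product of its own irreducible factors; a
weak map that is not an isomorphism strictly increases the number of independent sets. -/
theorem of_c_ne_zero {x y : MatroidClass} (h : x.c y ≠ 0) :
    x.size = y.size ∧ (x = y ∨ x.numIndep < y.numIndep) := by
  obtain ⟨M, rfl⟩ := x.exists_rep
  obtain ⟨N, rfl⟩ := y.exists_rep
  obtain ⟨f, hf⟩ := exists_isWeakMap (M := M) (N := N) h (irredFactors_spec N.cls).2.symm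
  refine ⟨?_, ?_⟩
  · rw [size_cls, size_cls, ← hf.1.image_eq, hf.1.injOn.ncard_image]
  · by_cases hlt : M.cls.numIndep < N.cls.numIndep
    · exact Or.inr hlt
    · exact Or.inl (cls_eq_iff.2 ⟨f, hf.isIsoMap (not_lt.1 hlt)⟩)

theorem c_self_ne_zero (x : MatroidClass) : x.c x ≠ 0 := by
  obtain ⟨M, rfl⟩ := x.exists_rep
  exact multisection_ne_zero (irredFactors_spec M.cls).2.symm

theorem exists_rep_ground (x : MatroidClass) :
    ∃ M : FinMatroid, M.cls = x ∧ M.toMatroid.E = Finset.range x.size := by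
  obtain ⟨M, rfl⟩ := x.exists_rep
  have hc : M.toMatroid.E.ncard = ((Finset.range M.cls.size : Finset ℕ) : Set ℕ).ncard := by
    rw [Set.ncard_coe_finset, Finset.card_range, size_cls]
  obtain ⟨f, hf⟩ := M.toMatroid.ground_finite.exists_bijOn_of_encard_eq
    (t := ((Finset.range M.cls.size : Finset ℕ) : Set ℕ)) (by
    rw [← M.toMatroid.ground_finite.cast_ncard_eq, hc, (Finset.finite_toSet _).cast_ncard_eq])
  have he : (M.toMatroid.map f hf.injOn).E = ((Finset.range M.cls.size : Finset ℕ) : Set ℕ) := by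
    rw [Matroid.map_ground, hf.image_eq]
  refine ⟨⟨M.toMatroid.map f hf.injOn, ⟨by rw [he]; exact Finset.finite_toSet _⟩⟩, ?_, he⟩
  exact Eq.symm (cls_eq_iff.2 ⟨f, isIsoMap_map hf.injOn⟩)

/-- There are finitely many matroids of each size. -/
theorem finite_size_eq (n : ℕ) : {x : MatroidClass | x.size = n}.Finite := by
  choose M hM hE using exists_rep_ground
  have hfin : (Set.powerset (Set.powerset ((Finset.range n : Finset ℕ) : Set ℕ))).Finite :=
    ((Finset.finite_toSet _).finite_subsets).finite_subsets
  -- With the ground set normalized to `{0, …, n - 1}`, a class is recovered from the collection of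
  -- independent sets of its representative.
  refine Set.Finite.of_injOn (f := fun x => {I | (M x).toMatroid.Indep I}) ?_ ?_ hfin
  · rintro x rfl I hI
    have := Matroid.Indep.subset_ground hI
    rwa [hE] at this
  · rintro x rfl y hy hxy
    rw [← hM x, ← hM y]
    congr 1
    refine ext' (Matroid.ext_indep ?_ fun I _ => ?_)
    · rw [hE, hE, hy]
    · exact Set.ext_iff.1 hxy I

end MatroidClass

open MatroidClass

/-! ### Members of the family as words in its irreducible members. -/

namespace MinorClosedFamily

variable {F : MinorClosedFamily}

/-- The factors are a restriction and a contraction of the product, hence minors. -/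
theorem mem_of_mul_mem {x y : MatroidClass} (h : x.mul y ∈ F.carrier) :
    x ∈ F.carrier ∧ y ∈ F.carrier := by
  obtain ⟨M, hM⟩ := (x.mul y).exists_rep
  obtain ⟨A, -, -, rfl, rfl⟩ := FinMatroid.exists_freeSeparator hM
  rw [← hM] at h
  exact ⟨F.restr_mem h A, F.contr_mem h A⟩

theorem mem_of_prod_mem {l : List MatroidClass} (h : prod l ∈ F.carrier) :
    ∀ y ∈ l, y ∈ F.carrier := by
  induction l with
  | nil => simp
  | cons x l ih =>
    obtain ⟨h1, h2⟩ := mem_of_mul_mem h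
    exact List.forall_mem_cons.2 ⟨h1, ih h2⟩

theorem FreeProductClosed.prod_mem (hF : F.FreeProductClosed) {l : List MatroidClass}
    (h : ∀ y ∈ l, y ∈ F.carrier) : prod l ∈ F.carrier := by
  induction l with
  | nil => exact F.one_mem
  | cons x l ih =>
    rw [List.forall_mem_cons] at h
    exact hF _ h.1 _ (ih h.2)

theorem isIrred_of_mem_map (l : List F.Irr) : ∀ y ∈ l.map fun i => i.1.1, IsIrred y := by
  intro y hy
  obtain ⟨i, -, rfl⟩ := List.mem_map.1 hy
  exact i.2

/-- Matroids in the family correspond to words in the irreducible matroids. -/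
noncomputable def FreeProductClosed.wordEquiv (hF : F.FreeProductClosed) :
    List F.Irr ≃ F.carrier :=
  Equiv.ofBijective
    (fun l => ⟨prod (l.map fun i => i.1.1), hF.prod_mem fun y hy => by
      obtain ⟨i, -, rfl⟩ := List.mem_map.1 hy
      exact i.1.2⟩) (by
    constructor
    · intro l l' h
      refine List.map_injective_iff.2 ?_ (eq_of_prod_eq (isIrred_of_mem_map l)
        (isIrred_of_mem_map l') (congrArg Subtype.val h))
      exact Subtype.val_injective.comp Subtype.val_injective
    · rintro ⟨x, hx⟩
      obtain ⟨h1, h2⟩ := irredFactors_spec x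
      have h3 : x.irredFactors ∈ Set.range (List.map fun i : F.Irr => i.1.1) := by
        rw [Set.range_list_map]
        intro y hy
        have hyF : y ∈ F.carrier := mem_of_prod_mem (by rwa [h2]) y hy
        exact ⟨⟨⟨y, hyF⟩, h1 y hy⟩, rfl⟩
      obtain ⟨l, hl⟩ := h3
      refine ⟨l, Subtype.ext ?_⟩
      change prod (List.map _ l) = x
      rw [hl, h2])

theorem FreeProductClosed.irredFactors_wordEquiv (hF : F.FreeProductClosed) (l : List F.Irr) :
    (hF.wordEquiv l).1.irredFactors = l.map fun i => i.1.1 :=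
  irredFactors_prod (isIrred_of_mem_map l)

theorem FreeProductClosed.wordEquiv_nil (hF : F.FreeProductClosed) :
    hF.wordEquiv [] = ⟨MatroidClass.one, F.one_mem⟩ := rfl

theorem FreeProductClosed.wordEquiv_singleton (hF : F.FreeProductClosed) (i : F.Irr) :
    hF.wordEquiv [i] = i.1 :=
  Subtype.ext (MatroidClass.mul_one i.1.1)

end MinorClosedFamily

/-! ### The dual basis and its deconcatenation property. -/

namespace MinorCoalgebra

open Coalgebra WithConv

variable (K : Type u) [Field K] (F : MinorClosedFamily)

/-- The functional which counts the multisections of type `l`. -/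
noncomputable def multisectionForm (l : List MatroidClass) : MinorCoalgebra K F →ₗ[K] K :=
  (classBasis K F).constr K fun N => (N.1.multisection l : K)

theorem multisectionForm_of (l : List MatroidClass) (M : FinMatroid) (hM : M.cls ∈ F.carrier) :
    multisectionForm K F l (of K F M hM) = M.multisection l := by
  rw [multisectionForm, of, Module.Basis.constr_basis]
  rfl

theorem pairP_eq_multisectionForm (M : F.carrier) :
    pairP K F M = multisectionForm K F M.1.irredFactors := rfl

theorem multisectionForm_nil : toConv (multisectionForm K F []) = 1 := by
  classical
  refine congrArg toConv ((classBasis K F).ext fun x => ?_)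
  obtain ⟨M, hM, hx⟩ := exists_of K F x
  rw [hx, multisectionForm_of, FinMatroid.multisection_nil]
  refine Eq.trans ?_ (counit_of K F M hM).symm
  have hE : M.toMatroid.E = ∅ ↔ M.ground = ∅ := by
    rw [← FinMatroid.coe_ground, Finset.coe_eq_empty]
  by_cases h : M.ground = ∅
  · rw [if_pos h, if_pos (hE.2 h), Nat.cast_one]
  · rw [if_neg h, if_neg (mt hE.1 h), Nat.cast_zero]

/-- Evaluated on `δ(M)`, the one-letter form keeps the terms with `M|A` of class `x`, and the sum
becomes the recursion `multisection_cons`. -/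
theorem multisectionForm_cons (x : MatroidClass) (l : List MatroidClass) :
    toConv (multisectionForm K F (x :: l)) =
      toConv (multisectionForm K F [x]) * toConv (multisectionForm K F l) := by
  classical
  refine congrArg toConv ((classBasis K F).ext fun y => ?_)
  obtain ⟨M, hM, hy⟩ := exists_of K F y
  rw [hy, multisectionForm_of, FinMatroid.multisection_cons]
  have hc : Coalgebra.comul (R := K) (of K F M hM) = delta K F M hM := comul_of K F M hM
  simp only [LinearMap.comp_apply]
  rw [hc, delta, map_sum, map_sum, Nat.cast_sum]
  refine Finset.sum_congr rfl fun A _ => ?_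
  rw [TensorProduct.map_tmul, LinearMap.mul'_apply]
  change _ = multisectionForm K F [x] _ * multisectionForm K F l _
  rw [multisectionForm_of, multisectionForm_of, FinMatroid.multisection_singleton]
  split_ifs <;> simp

/-- Nonzero coefficients require equal sizes, which leaves finitely many `M`. -/
theorem finite_c_ne_zero (N : F.carrier) :
    (Function.support fun M : F.carrier => (MatroidClass.c N.1 M.1 : K)).Finite := by
  refine Set.Finite.subset ((finite_size_eq N.1.size).preimage Subtype.val_injective.injOn) ?_
  intro M hM
  refine (of_c_ne_zero (x := N.1) (y := M.1) fun h => hM ?_).1.symm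
  simp [h]

/-- The map whose coordinates are the pairings with the `P_M`. -/
noncomputable def pairing : MinorCoalgebra K F →ₗ[K] F.carrier →₀ K :=
  (classBasis K F).constr K fun N => Finsupp.ofSupportFinite _ (finite_c_ne_zero K F N)

theorem pairing_basis_apply (N M : F.carrier) :
    pairing K F (classBasis K F N) M = (MatroidClass.c N.1 M.1 : K) := by
  rw [pairing, Module.Basis.constr_basis]
  rfl

theorem pairing_apply (x : MinorCoalgebra K F) (M : F.carrier) :
    pairing K F x M = pairP K F M x := by
  have h : Finsupp.lapply M ∘ₗ pairing K F = pairP K F M := by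
    refine (classBasis K F).ext fun N => ?_
    rw [LinearMap.comp_apply, Finsupp.lapply_apply, pairing_basis_apply, pairP,
      Module.Basis.constr_basis]
  rw [← h]
  rfl

theorem mem_of_forall_single_mem {ι : Type*} {p : Submodule K (ι →₀ K)} {f : ι →₀ K}
    (h : ∀ i ∈ f.support, Finsupp.single i 1 ∈ p) : f ∈ p := by
  rw [← f.sum_single]
  refine Submodule.sum_mem _ fun i hi => ?_
  have := p.smul_mem (f i) (h i hi)
  rwa [Finsupp.smul_single, smul_eq_mul, _root_.mul_one] at this

variable [CharZero K]

theorem pairing_injective : Function.Injective (pairing K F) := by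
  rw [injective_iff_map_eq_zero]
  intro x hx
  by_contra hne
  have hs : ((classBasis K F).repr x).support.Nonempty := by
    rw [Finsupp.support_nonempty_iff]
    simpa using hne
  -- With `M` having the fewest independent sets in the support of `x`, triangularity removes every
  -- other contribution to the coordinate at `M`.
  obtain ⟨M, hM, hmin⟩ := Finset.exists_min_image _ (fun N : F.carrier => N.1.numIndep) hs
  have h : pairing K F x M = (classBasis K F).repr x M * (MatroidClass.c M.1 M.1 : K) := by
    conv_lhs => rw [← (classBasis K F).linearCombination_repr x]
    rw [Finsupp.linearCombination_apply, Finsupp.sum, map_sum, Finsupp.finsetSum_apply,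
      Finset.sum_eq_single M]
    · rw [map_smul, Finsupp.smul_apply, pairing_basis_apply, smul_eq_mul]
    · intro N hN hNM
      rw [map_smul, Finsupp.smul_apply, pairing_basis_apply, smul_eq_mul]
      by_cases hc : MatroidClass.c N.1 M.1 = 0
      · simp [hc]
      · rcases (of_c_ne_zero hc).2 with h | h
        · exact absurd (Subtype.ext h) hNM
        · exact absurd h (not_lt.2 (hmin N hN))
    · exact fun h => absurd hM h
  rw [hx, Finsupp.coe_zero, Pi.zero_apply] at h
  exact mul_ne_zero (Finsupp.mem_support_iff.1 hM) (Nat.cast_ne_zero.2 (c_self_ne_zero M.1)) h.symm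

/-- The image of `N` is a nonzero multiple of the unit vector at `N` plus terms at strictly freer
matroids of the same size. The induction runs on the deficit `2 ^ size - numIndep`, which
`numIndep_le` makes decreasing. -/
theorem single_mem_range_pairing (N : F.carrier) :
    Finsupp.single N 1 ∈ LinearMap.range (pairing K F) := by
  induction h : 2 ^ N.1.size - N.1.numIndep using Nat.strong_induction_on generalizing N with
  | _ n ih =>
    classical
    set g := pairing K F (classBasis K F N) with hg
    have h1 : g.erase N ∈ LinearMap.range (pairing K F) := by
      refine mem_of_forall_single_mem K fun M hM => ?_
      rw [Finsupp.support_erase, Finset.mem_erase, Finsupp.mem_support_iff, hg,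
        pairing_basis_apply, Nat.cast_ne_zero] at hM
      obtain ⟨h2, h3⟩ := of_c_ne_zero hM.2
      have h4 := h3.resolve_left fun h => hM.1 (Subtype.ext h.symm)
      have h5 := M.1.numIndep_le
      exact ih _ (by rw [h2] at h; omega) M rfl
    have h2 : Finsupp.single N (g N) ∈ LinearMap.range (pairing K F) := by
      rw [← (LinearMap.range (pairing K F)).add_mem_iff_left h1, Finsupp.single_add_erase]
      exact ⟨_, rfl⟩
    have h3 : g N ≠ 0 := by
      rw [hg, pairing_basis_apply]
      exact Nat.cast_ne_zero.2 (c_self_ne_zero N.1)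
    have h4 := (LinearMap.range (pairing K F)).smul_mem (g N)⁻¹ h2
    rwa [Finsupp.smul_single, smul_eq_mul, inv_mul_cancel₀ h3] at h4

theorem pairing_bijective : Function.Bijective (pairing K F) :=
  ⟨pairing_injective K F, fun f => mem_of_forall_single_mem K (f := f)
    fun M _ => single_mem_range_pairing K F M⟩

/-- The basis dual to the family of the `P_M`. -/
noncomputable def dualBasis : Module.Basis F.carrier K (MinorCoalgebra K F) :=
  Module.Basis.ofRepr (LinearEquiv.ofBijective (pairing K F) (pairing_bijective K F))

theorem coord_dualBasis (M : F.carrier) : (dualBasis K F).coord M = pairP K F M :=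
  LinearMap.ext fun x => pairing_apply K F x M

theorem isDualToP_dualBasis : IsDualToP K F (dualBasis K F) := by
  classical
  intro M N
  rw [← coord_dualBasis, Module.Basis.coord_apply, Module.Basis.repr_self, Finsupp.single_apply]

theorem IsDualToP.eq_dualBasis {Q : F.carrier → MinorCoalgebra K F} (h : IsDualToP K F Q) :
    Q = dualBasis K F := by
  funext M
  refine pairing_injective K F (Finsupp.ext fun N => ?_)
  rw [pairing_apply, pairing_apply, h, isDualToP_dualBasis]

/-- The empty matroid is alone in size zero, so its block of the coefficient matrix is the single
entry `1`. -/
theorem dualBasis_one : dualBasis K F ⟨MatroidClass.one, F.one_mem⟩ = emptyElem K F := by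
  refine (dualBasis K F).ext_elem fun N => ?_
  rw [← Module.Basis.coord_apply, ← Module.Basis.coord_apply, coord_dualBasis,
    isDualToP_dualBasis, emptyElem, ← pairing_apply, pairing_basis_apply]
  split_ifs with h
  · subst h
    have h1 : MatroidClass.one.irredFactors = [] := irredFactors_prod (l := []) (by simp)
    change (1 : K) = (FinMatroid.empty.multisection MatroidClass.one.irredFactors : K)
    rw [h1, FinMatroid.multisection_nil, if_pos (FinMatroid.cls_eq_one_iff.1 rfl), Nat.cast_one]
  · symm
    rw [Nat.cast_eq_zero]
    by_contra hc
    have h1 := (of_c_ne_zero hc).1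
    rw [size_eq_zero.2 rfl] at h1
    exact h (Subtype.ext (size_eq_zero.1 h1.symm).symm)

variable {F} (hF : F.FreeProductClosed)

/-- The dual basis, indexed by words in the irreducible matroids. -/
noncomputable def wordBasis : Module.Basis (List F.Irr) K (MinorCoalgebra K F) :=
  (dualBasis K F).reindex hF.wordEquiv.symm

theorem wordBasis_apply (l : List F.Irr) :
    wordBasis K hF l = dualBasis K F (hF.wordEquiv l) := by
  rw [wordBasis, Module.Basis.reindex_apply, Equiv.symm_symm]

theorem coord_wordBasis (l : List F.Irr) :
    (wordBasis K hF).coord l = multisectionForm K F (l.map fun i => i.1.1) := by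
  rw [← hF.irredFactors_wordEquiv, ← pairP_eq_multisectionForm, ← coord_dualBasis]
  ext x
  rw [Module.Basis.coord_apply, Module.Basis.coord_apply, wordBasis,
    Module.Basis.repr_reindex_apply, Equiv.symm_symm]

/-- By unique factorization, the coordinate along a word is the multisection form of that word, so
the convolution recursion for these forms applies. -/
theorem isDeconcatenation_wordBasis : IsDeconcatenation (wordBasis K hF) where
  nil := by
    rw [coord_wordBasis]
    exact multisectionForm_nil K F
  cons i w := by
    rw [coord_wordBasis, coord_wordBasis, coord_wordBasis]
    exact multisectionForm_cons K F i.1.1 _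

theorem wordBasis_nil : wordBasis K hF [] = emptyElem K F := by
  rw [wordBasis_apply, hF.wordEquiv_nil, dualBasis_one]

theorem wordBasis_singleton (i : F.Irr) : wordBasis K hF [i] = dualBasis K F i.1 := by
  rw [wordBasis_apply, hF.wordEquiv_singleton]

end MinorCoalgebra

end FreeProd

theorem mainTheorem10 (K : Type u) [Field K] [CharZero K] (F : MinorClosedFamily)
    (hF : F.FreeProductClosed) :
    ∃ Q : Module.Basis F.carrier K (MinorCoalgebra K F),
      MinorCoalgebra.IsDualToP K F Q ∧
      (∀ Q' : F.carrier → MinorCoalgebra K F, MinorCoalgebra.IsDualToP K F Q' → Q' = Q) ∧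
      (∃ p : MinorCoalgebra K F →ₗ[K] (F.Irr →₀ K),
        IsCofreeOn.{u, u, u, w} K (MinorCoalgebra.emptyElem K F) p ∧
        ∀ M : F.Irr, p (Q M.1) = Finsupp.single M 1) ∧
      LinearIndependent K (fun M : F.Irr => Q M.1) ∧
      Submodule.span K (Set.range fun M : F.Irr => Q M.1) =
        primitives K (MinorCoalgebra.emptyElem K F) := by
  have hW := MinorCoalgebra.isDeconcatenation_wordBasis K hF
  have hinj : Function.Injective fun i : F.Irr => [i] := List.singleton_injective
  refine ⟨MinorCoalgebra.dualBasis K F, MinorCoalgebra.isDualToP_dualBasis K F,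
    fun Q' hQ' => MinorCoalgebra.IsDualToP.eq_dualBasis K F hQ',
    -- The projection reads off the coefficients on one-letter words.
    ⟨Finsupp.lcomapDomain _ hinj ∘ₗ (MinorCoalgebra.wordBasis K hF).repr.toLinearMap, ?_, ?_⟩,
    ?_, ?_⟩
  · rw [← MinorCoalgebra.wordBasis_nil K hF]
    exact hW.isCofreeOn _ fun x i => rfl
  · intro i
    rw [← MinorCoalgebra.wordBasis_singleton K hF, LinearMap.comp_apply, LinearEquiv.coe_coe,
      Module.Basis.repr_self]
    exact Finsupp.comapDomain_single _ i 1 hinj.injOn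
  · exact (MinorCoalgebra.dualBasis K F).linearIndependent.comp _ Subtype.val_injective
  · simp only [← MinorCoalgebra.wordBasis_singleton K hF, ← MinorCoalgebra.wordBasis_nil K hF]
    exact hW.span_eq_primitives
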